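/- **Setting.** A sequence $(Z_i)_{i\ge1}$ of real random variables is *negatively associated (NA)* if for all disjoint finite index sets $A,B$ and all measurable functions $\varphi,\psi$ that are both coordinatewise increasing or both coordinatewise decreasing, $\operatorname{Cov}(\varphi(Z_i;i\in A),\psi(Z_j;j\in B))\le 0$ whenever this covariance exists. Let $(T_i)_{i\ge1}$ and $(Y_i)_{i\ge1}$ be NA sequences of nonnegative random variables on one probability space, the two sequences being independent of each other. All $T_i$ have the same continuous distribution function $F$, and all $Y_i$ have the same distribution function $G$. The observations are $X_i=\min(T_i,Y_i)$ and $\delta_i=I(T_i\le Y_i)$. Let $L$ be the distribution function of $X_1$, $\tau_L=\sup\{x:L(x)<1\}\in(0,\infty]$ and $a_F=\inf\{x:F(x)>0\}$. Put $N_n(t)=\sum_{i\le n}I(X_i\le t,\delta_i=1)$, $Y_n(t)=\sum_{i\le n}I(X_i\ge t)$, and let $\hat F_n$ be the Kaplan–Meier estimator, $$1-\hat F_n(t)=\prod_{s\le t}\Bigl(1-\frac{N_n(s)-N_n(s-)}{Y_n(s)}\Bigr),$$ where the product runs over the observed values $s\le t$. Let $k$ be a probability density on $\mathbb R$ that vanishes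 outside a finite interval $(r,s)$ with $r<0<s$ and is of bounded variation on it, and let $b_n>0$ with $b_n\to0$. Define $$f_n(t)=b_n^{-1}\int_{a_F}^\infty k\Bigl(\frac{t-x}{b_n}\Bigr)d\hat F_n(x),\quad \bar f_n(t)=b_n^{-1}\int_{a_F}^\infty k\Bigl(\frac{t-x}{b_n}\Bigr)dF(x),\quad f_n^*(t)=b_n^{-1}\int_{a_F}^\infty k\Bigl(\frac{t-x}{b_n}\Bigr)dF_{*n}(x),$$ where $F_{*n}(x)=\frac1n\sum_{i\le n}I(X_i\le x,\delta_i=1)$. **Theorem 1.** Let $a_F<\tau<\tau_L$, and suppose that on $[0,\tau]$ the functions $F$ and $G$ have densities $f$ and $g$ that are bounded there. If $b_n^{-1}=o\bigl((n/\ln n)^{1/2}\bigr)$, then almost surely $$\sup_{0<t\le\tau}\left|f_n(t)-\bar f_n(t)-\frac{f_n^*(t)-E f_n^*(t)}{1-G(t)}\right|=O\bigl(b_n^{-1}(\ln n/n)^{1/2}\bigr)\qquad(n\to\infty),$$ where the implied constant may depend on the realization. The same holds if $F_{*n}$ in the definition of $f_n^*$ is replaced by the empirical distribution function $\frac1n\sum_{i\le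 n}I(T_i\le x)$ of the lifetimes. -/

import Mathlib

open MeasureTheory ProbabilityTheory Set Filter Topology Asymptotics

noncomputable section

namespace CensoredNA

/-- A sequence of real random variables is negatively associated: for disjoint finite index sets
`A`, `B` and functions `φ`, `ψ` that are both coordinatewise increasing or both coordinatewise
decreasing, `φ (Z i, i ∈ A)` and `ψ (Z j, j ∈ B)` have nonpositive covariance whenever that
covariance exists. -/
def NegAssociated {Ω : Type*} [MeasurableSpace Ω] (μ : Measure Ω) (Z : ℕ → Ω → ℝ) : Prop :=
  ∀ (A B : Finset ℕ), Disjoint A B →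
    ∀ (φ : (A → ℝ) → ℝ) (ψ : (B → ℝ) → ℝ), Measurable φ → Measurable ψ →
      ((Monotone φ ∧ Monotone ψ) ∨ (Antitone φ ∧ Antitone ψ)) →
      Integrable (fun ω => φ (fun i => Z i ω)) μ →
      Integrable (fun ω => ψ (fun j => Z j ω)) μ →
      Integrable (fun ω => φ (fun i => Z i ω) * ψ (fun j => Z j ω)) μ →
      cov[fun ω => φ (fun i => Z i ω), fun ω => ψ (fun j => Z j ω); μ] ≤ 0

/-- Left endpoint `a_H = inf {x : H x > 0}` of a distribution function of a nonnegative random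
variable. -/
def leftEndpoint (H : ℝ → ℝ) : ℝ := sInf {x : ℝ | 0 < H x}

/-- Right endpoint `τ_H = sup {x : H x < 1}`, possibly `+∞`. -/
def rightEndpoint (H : ℝ → ℝ) : EReal := sSup ((fun x : ℝ => (x : EReal)) '' {x : ℝ | H x < 1})

/-- On `[0, τ]` the function `H` has the density `h`, and `h` is bounded there. -/
def HasBoundedDensityOn (H h : ℝ → ℝ) (τ : ℝ) : Prop :=
  IntegrableOn h (Icc 0 τ) ∧ (∀ x ∈ Icc 0 τ, H x - H 0 = ∫ u in (0 : ℝ)..x, h u) ∧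
    ∃ M : ℝ, ∀ x ∈ Icc 0 τ, |h x| ≤ M

/-- A bounded variation probability density on the finite interval `(r, s)`. -/
def IsBVKernel (k : ℝ → ℝ) (r s : ℝ) : Prop :=
  (∀ u, 0 ≤ k u) ∧ (∀ u, u ∉ Ioo r s → k u = 0) ∧ (∫ u, k u) = 1 ∧
    BoundedVariationOn k (Ioo r s)

section Estimators

open Classical in
/-- `Y_n(s)`: the number of the first `n` observations `x k` that are at least `s`. -/
def atRisk (n : ℕ) (x : ℕ → ℝ) (s : ℝ) : ℕ := ((Finset.range n).filter fun k => s ≤ x k).card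

open Classical in
/-- `N_n(s)`: the number of the first `n` observations that are at most `s` and uncensored
(`δ k` says that the observation `x k` is uncensored). -/
def events (n : ℕ) (x : ℕ → ℝ) (δ : ℕ → Prop) (s : ℝ) : ℕ :=
  ((Finset.range n).filter fun k => x k ≤ s ∧ δ k).card

open Classical in
/-- The jump `dN_n(s) = N_n(s) - N_n(s-)`: the number of uncensored observations equal to `s`. -/
def eventJump (n : ℕ) (x : ℕ → ℝ) (δ : ℕ → Prop) (s : ℝ) : ℕ :=
  ((Finset.range n).filter fun k => x k = s ∧ δ k).card

open Classical in
/-- The Kaplan-Meier survival estimate `∏_{s ≤ t} (1 - dN_n(s) / Y_n(s))`; the product runs over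
the distinct observed values, all other factors being `1`. -/
def kmSurv (n : ℕ) (x : ℕ → ℝ) (δ : ℕ → Prop) (t : ℝ) : ℝ :=
  ∏ s ∈ ((Finset.range n).image x).filter (fun s => s ≤ t),
    (1 - (eventJump n x δ s : ℝ) / (atRisk n x s : ℝ))

lemma filter_le_eventually_eq (S : Finset ℝ) (a : ℝ) :
    ∀ᶠ t in 𝓝[≥] a, ∀ s ∈ S, (s ≤ t ↔ s ≤ a) := by
  rw [Filter.eventually_all_finset]
  intro s _
  by_cases h : s ≤ a
  · filter_upwards [self_mem_nhdsWithin] with t ht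
    exact ⟨fun _ => h, fun _ => h.trans ht⟩
  · have h' : a < s := not_le.mp h
    filter_upwards [mem_nhdsWithin_of_mem_nhds (Iio_mem_nhds h')] with t ht
    exact ⟨fun h2 => absurd h2 (not_le.mpr ht), fun h2 => absurd h2 h⟩

lemma kmFactor_mem (n : ℕ) (x : ℕ → ℝ) (δ : ℕ → Prop) (s : ℝ) :
    0 ≤ 1 - (eventJump n x δ s : ℝ) / (atRisk n x s : ℝ) ∧
      1 - (eventJump n x δ s : ℝ) / (atRisk n x s : ℝ) ≤ 1 := by
  classical
  have h : (eventJump n x δ s : ℝ) ≤ (atRisk n x s : ℝ) := by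
    unfold eventJump atRisk
    refine Nat.cast_le.mpr (Finset.card_le_card fun k hk => ?_)
    rw [Finset.mem_filter] at hk ⊢
    exact ⟨hk.1, hk.2.1.ge⟩
  have h0 : (0 : ℝ) ≤ (eventJump n x δ s : ℝ) / (atRisk n x s : ℝ) := by positivity
  have h1 := div_le_one_of_le₀ h (Nat.cast_nonneg _)
  constructor <;> linarith

/-- The Kaplan-Meier estimator `F̂_n`. -/
def kmCDF (n : ℕ) (x : ℕ → ℝ) (δ : ℕ → Prop) : StieltjesFunction ℝ where
  toFun t := 1 - kmSurv n x δ t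
  mono' := by
    classical
    intro t t' htt
    have : kmSurv n x δ t' ≤ kmSurv n x δ t := by
      unfold kmSurv
      have hsub : ((Finset.range n).image x).filter (fun s => s ≤ t) ⊆
          ((Finset.range n).image x).filter (fun s => s ≤ t') := fun s hs => by
        rw [Finset.mem_filter] at hs ⊢
        exact ⟨hs.1, hs.2.trans htt⟩
      rw [← Finset.prod_sdiff hsub]
      exact mul_le_of_le_one_left
        (Finset.prod_nonneg fun s _ => (kmFactor_mem n x δ s).1)
        (Finset.prod_le_one (fun s _ => (kmFactor_mem n x δ s).1)
          fun s _ => (kmFactor_mem n x δ s).2)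
    exact sub_le_sub_left this 1
  right_continuous' a := by
    classical
    refine ContinuousWithinAt.congr_of_eventuallyEq
      (f := fun _ => 1 - kmSurv n x δ a) continuousWithinAt_const ?_ rfl
    filter_upwards [filter_le_eventually_eq ((Finset.range n).image x) a] with t ht
    unfold kmSurv
    congr 2
    ext s
    simp only [Finset.mem_filter]
    exact and_congr_right fun hs => ht s hs

/-- The empirical (sub-)distribution function `t ↦ (1/n) #{k : x k ≤ t, δ k}` of the first `n`
observations. -/
def empCDF (n : ℕ) (x : ℕ → ℝ) (δ : ℕ → Prop) : StieltjesFunction ℝ where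
  toFun t := (1 / (n : ℝ)) * (events n x δ t : ℝ)
  mono' := by
    classical
    intro t t' htt
    have : events n x δ t ≤ events n x δ t' := by
      unfold events
      exact Finset.card_le_card
        (Finset.monotone_filter_right _ fun k _ hk => ⟨hk.1.trans htt, hk.2⟩)
    have h2 : (events n x δ t : ℝ) ≤ (events n x δ t' : ℝ) := by exact_mod_cast this
    exact mul_le_mul_of_nonneg_left h2 (by positivity)
  right_continuous' a := by
    classical
    refine ContinuousWithinAt.congr_of_eventuallyEq
      (f := fun _ => (1 / (n : ℝ)) * (events n x δ a : ℝ)) continuousWithinAt_const ?_ rfl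
    filter_upwards [filter_le_eventually_eq ((Finset.range n).image x) a] with t ht
    have : events n x δ t = events n x δ a := by
      unfold events
      congr 1
      ext k
      simp only [Finset.mem_filter]
      refine and_congr_right fun hk => and_congr_left fun _ => ?_
      exact ht (x k) (Finset.mem_image_of_mem x hk)
    simp only [this]

/-- `b⁻¹ ∫_a^∞ k((t - x)/b) dH(x)`. -/
def kernelSmooth (k : ℝ → ℝ) (b a : ℝ) (H : StieltjesFunction ℝ) (t : ℝ) : ℝ :=
  b⁻¹ * ∫ x in Ici a, k ((t - x) / b) ∂H.measure

end Estimators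

section Model

variable {Ω : Type*}

/-- The observed times `X_i = min (T_i, Y_i)`. -/
def obs (T Y : ℕ → Ω → ℝ) (i : ℕ) (ω : Ω) : ℝ := min (T i ω) (Y i ω)

/-- The event `δ_i = 1`, that is, `T_i ≤ Y_i`. -/
def uncensored (T Y : ℕ → Ω → ℝ) (i : ℕ) (ω : Ω) : Prop := T i ω ≤ Y i ω

/-- `f_n(t) = b_n⁻¹ ∫_{a_F}^∞ k((t - x)/b_n) dF̂_n(x)`. -/
def fHat (k : ℝ → ℝ) (b : ℕ → ℝ) (F : StieltjesFunction ℝ) (T Y : ℕ → Ω → ℝ)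
    (n : ℕ) (t : ℝ) (ω : Ω) : ℝ :=
  kernelSmooth k (b n) (leftEndpoint F)
    (kmCDF n (fun i => obs T Y i ω) (fun i => uncensored T Y i ω)) t

/-- `f̄_n(t) = b_n⁻¹ ∫_{a_F}^∞ k((t - x)/b_n) dF(x)`. -/
def fBar (k : ℝ → ℝ) (b : ℕ → ℝ) (F : StieltjesFunction ℝ) (n : ℕ) (t : ℝ) : ℝ :=
  kernelSmooth k (b n) (leftEndpoint F) F t

/-- `f_n^*(t) = b_n⁻¹ ∫_{a_F}^∞ k((t - x)/b_n) dF_{*n}(x)`, where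
`F_{*n}(x) = (1/n) #{i : X_i ≤ x, δ_i = 1}`. -/
def fStar (k : ℝ → ℝ) (b : ℕ → ℝ) (F : StieltjesFunction ℝ) (T Y : ℕ → Ω → ℝ)
    (n : ℕ) (t : ℝ) (ω : Ω) : ℝ :=
  kernelSmooth k (b n) (leftEndpoint F)
    (empCDF n (fun i => obs T Y i ω) (fun i => uncensored T Y i ω)) t

/-- The same smoother applied to the empirical distribution function
`(1/n) #{i : T_i ≤ x}` of the lifetimes themselves. -/
def fStarLife (k : ℝ → ℝ) (b : ℕ → ℝ) (F : StieltjesFunction ℝ) (T : ℕ → Ω → ℝ)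
    (n : ℕ) (t : ℝ) (ω : Ω) : ℝ :=
  kernelSmooth k (b n) (leftEndpoint F) (empCDF n (fun i => T i ω) (fun _ => True)) t

end Model

end CensoredNA

end

/-!
At the rate `b_n⁻¹ (log n / n)^{1/2}` the smoothed Kaplan–Meier error and the linear term need not
cancel: each of them is already of that order.

For a pair of independent negatively associated sequences and a function `H (t, y)` that is monotone
in each variable, conditioning on the second sequence and applying negative association twice gives
`E ∏ H (T_i, Y_i) ≤ ∏ E H (T_i, Y_i)`. With `H` an exponential of the indicator of a set, this is
all that Hoeffding's inequality needs, and a grid of `n` quantiles together with Borel–Cantelli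
makes it uniform over half-lines: the empirical distribution functions of the observed times and of
the uncensored ones are within `O((log n / n)^{1/2})` of their limits. The Kaplan–Meier product is
close to the exponential of minus the Nelson–Aalen estimator, which in turn is close to the
cumulative hazard `-log (1 - F)`, so `F̂_n - F` has the same rate up to any point below `τ_L`.
Finally, a kernel of bounded variation is a difference of monotone functions on its window, so
smoothing turns an `ε`-error between distribution functions into an error `O(b_n⁻¹ ε)`.
-/

namespace CensoredNA

section CdfDistance

/-- The distribution functions of `μ` and `ν` differ by at most `ε` on `(-∞, c]`. The comparison
stops at `c` because the Kaplan–Meier estimator is uniformly consistent only to the left of the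
right endpoint of the observations. -/
def CdfDistLE (μ ν : Measure ℝ) (c ε : ℝ) : Prop :=
  ∀ x ≤ c, |μ.real (Iic x) - ν.real (Iic x)| ≤ ε

variable {μ ν : Measure ℝ} {c ε : ℝ}

lemma CdfDistLE.nonneg (h : CdfDistLE μ ν c ε) : 0 ≤ ε := (abs_nonneg _).trans (h c le_rfl)

lemma tendsto_measureReal_Iic_of_strictMono (μ : Measure ℝ) [IsFiniteMeasure μ] {a : ℝ}
    {u : ℕ → ℝ} (hu : StrictMono u) (hlt : ∀ n, u n < a) (hlim : Tendsto u atTop (𝓝 a)) :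
    Tendsto (fun n => μ.real (Iic (u n))) atTop (𝓝 (μ.real (Iio a))) := by
  have h := tendsto_measure_iUnion_atTop (μ := μ) (s := fun n => Iic (u n))
    (fun i j hij => Iic_subset_Iic.2 (hu.monotone hij))
  rw [iUnion_Iic_eq_Iio_of_lt_of_tendsto hlt hlim] at h
  exact (ENNReal.tendsto_toReal (measure_ne_top _ _)).comp h

variable [IsFiniteMeasure μ] [IsFiniteMeasure ν]

lemma CdfDistLE.abs_measureReal_Iio_sub_le (h : CdfDistLE μ ν c ε) {a : ℝ} (ha : a ≤ c) :
    |μ.real (Iio a) - ν.real (Iio a)| ≤ ε := by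
  obtain ⟨u, hu, hlt, hlim⟩ := exists_seq_strictMono_tendsto a
  exact le_of_tendsto ((tendsto_measureReal_Iic_of_strictMono μ hu hlt hlim).sub
    (tendsto_measureReal_Iic_of_strictMono ν hu hlt hlim)).abs
    (Eventually.of_forall fun n => h _ ((hlt n).le.trans ha))

lemma eq_Iic_or_eq_Iio_of_isLowerSet {D : Set ℝ} (hD : IsLowerSet D) (hne : D.Nonempty)
    (hbdd : BddAbove D) : D = Iic (sSup D) ∨ D = Iio (sSup D) := by
  by_cases hmem : sSup D ∈ D
  · exact Or.inl (Subset.antisymm (fun x hx => le_csSup hbdd hx) fun x hx => hD hx hmem)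
  · refine Or.inr (Subset.antisymm
      (fun x hx => (le_csSup hbdd hx).lt_of_ne fun h => hmem (h ▸ hx)) fun x hx => ?_)
    obtain ⟨y, hy, hxy⟩ := exists_lt_of_lt_csSup hne hx
    exact hD hxy.le hy

lemma CdfDistLE.abs_measureReal_sub_le_of_isLowerSet (h : CdfDistLE μ ν c ε) {D : Set ℝ}
    (hD : IsLowerSet D) (hDc : D ⊆ Iic c) : |μ.real D - ν.real D| ≤ ε := by
  rcases D.eq_empty_or_nonempty with rfl | hne
  · simpa using h.nonneg
  have hsup : sSup D ≤ c := csSup_le hne hDc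
  rcases eq_Iic_or_eq_Iio_of_isLowerSet hD hne ⟨c, hDc⟩ with hE | hE
  · rw [hE]; exact h _ hsup
  · rw [hE]; exact h.abs_measureReal_Iio_sub_le hsup

lemma exists_isLowerSet_sdiff_eq {S : Set ℝ} (hS : S.OrdConnected) (hSc : S ⊆ Iic c) :
    ∃ A B, IsLowerSet A ∧ IsLowerSet B ∧ B ⊆ A ∧ A ⊆ Iic c ∧ S = A \ B := by
  refine ⟨lowerClosure S, lowerClosure S \ S, (lowerClosure S).lower, ?_, sdiff_subset,
    fun x ⟨y, hy, hxy⟩ => hxy.trans (hSc hy), (sdiff_sdiff_cancel_left subset_lowerClosure).symm⟩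
  rintro x y hyx ⟨⟨z, hz, hxz⟩, hxS⟩
  exact ⟨⟨z, hz, hyx.trans hxz⟩, fun hyS => hxS (hS.out hyS hz ⟨hyx, hxz⟩)⟩

lemma CdfDistLE.abs_measureReal_sub_le_of_ordConnected (h : CdfDistLE μ ν c ε) {S : Set ℝ}
    (hS : S.OrdConnected) (hSc : S ⊆ Iic c) : |μ.real S - ν.real S| ≤ 2 * ε := by
  obtain ⟨A, B, hA, hB, hBA, hAc, rfl⟩ := exists_isLowerSet_sdiff_eq hS hSc
  have hBm : MeasurableSet B := hB.ordConnected.measurableSet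
  rw [measureReal_sdiff hBA hBm, measureReal_sdiff hBA hBm, sub_sub_sub_comm, two_mul]
  exact (abs_sub _ _).trans (add_le_add (h.abs_measureReal_sub_le_of_isLowerSet hA hAc)
    (h.abs_measureReal_sub_le_of_isLowerSet hB (hBA.trans hAc)))

variable {J : Set ℝ} {φ : ℝ → ℝ} {M : ℝ}

lemma integrableOn_of_quasiconcaveOn (hφ : QuasiconcaveOn ℝ J φ) (hJ : J.OrdConnected)
    (hM : ∀ x ∈ J, |φ x| ≤ M) (μ : Measure ℝ) [IsFiniteMeasure μ] : IntegrableOn φ J μ := by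
  refine IntegrableOn.of_bound (measure_lt_top _ _) ?_ M
    ((ae_restrict_iff' hJ.measurableSet).2 (Eventually.of_forall hM))
  refine (aemeasurable_restrict_iff_comap_subtype hJ.measurableSet |>.2
    (Measurable.aemeasurable ?_)).aestronglyMeasurable
  refine measurable_of_Ici fun u => ⟨{x ∈ J | u ≤ φ x}, (hφ u).ordConnected.measurableSet, ?_⟩
  ext x
  simp

/-- Layer-cake representation: the superlevel sets of a quasiconcave function are intervals. -/
lemma CdfDistLE.abs_setIntegral_sub_le_of_quasiconcaveOn (h : CdfDistLE μ ν c ε)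
    (hJ : J.OrdConnected) (hJc : J ⊆ Iic c) (hφ : QuasiconcaveOn ℝ J φ)
    (h0 : ∀ x ∈ J, 0 ≤ φ x) (hM : ∀ x ∈ J, φ x ≤ M) (hM0 : 0 ≤ M) :
    |∫ x in J, φ x ∂μ - ∫ x in J, φ x ∂ν| ≤ 2 * ε * M := by
  have hJm := hJ.measurableSet
  have layer_cake : ∀ (ρ : Measure ℝ) [IsFiniteMeasure ρ],
      ∫ x in J, φ x ∂ρ = ∫ u in Ioc 0 M, ρ.real {x ∈ J | u ≤ φ x} := fun ρ _ => by
    rw [(integrableOn_of_quasiconcaveOn hφ hJ (fun x hx => (abs_of_nonneg (h0 x hx)).trans_le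
      (hM x hx)) ρ).integral_eq_integral_Ioc_meas_le
      ((ae_restrict_iff' hJm).2 (Eventually.of_forall h0))
      ((ae_restrict_iff' hJm).2 (Eventually.of_forall hM))]
    simp only [measureReal_restrict_apply' hJm, inter_comm _ J]
    rfl
  have hint : ∀ (ρ : Measure ℝ) [IsFiniteMeasure ρ],
      IntegrableOn (fun u => ρ.real {x ∈ J | u ≤ φ x}) (Ioc 0 M) := fun ρ _ => by
    have hanti : Antitone fun u => ρ.real {x ∈ J | u ≤ φ x} := fun u v huv =>
      measureReal_mono fun x hx => ⟨hx.1, huv.trans hx.2⟩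
    exact (hanti.antitoneOn _).integrableOn_isCompact isCompact_Icc |>.mono_set Ioc_subset_Icc_self
  rw [layer_cake μ, layer_cake ν, ← integral_sub (hint μ) (hint ν), ← Real.norm_eq_abs]
  refine (norm_setIntegral_le_of_norm_le_const measure_Ioc_lt_top fun u _ => ?_).trans_eq
    (by simp [hM0] : 2 * ε * volume.real (Ioc 0 M) = 2 * ε * M)
  exact h.abs_measureReal_sub_le_of_ordConnected (hφ u).ordConnected
    ((sep_subset _ _).trans hJc)

end CdfDistance

section BoundedVariation

variable {J : Set ℝ} {φ : ℝ → ℝ} {M : ℝ}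

lemma exists_monotoneOn_sub_of_boundedVariationOn (hφ : BoundedVariationOn φ J)
    (hM : ∀ x ∈ J, |φ x| ≤ M) :
    ∃ p q : ℝ → ℝ, MonotoneOn p J ∧ MonotoneOn q J ∧ EqOn φ (p - q) J ∧
      ∀ x ∈ J, p x ∈ Icc 0 (2 * ((eVariationOn φ J).toReal + M)) ∧
        q x ∈ Icc 0 (2 * ((eVariationOn φ J).toReal + M)) := by
  rcases J.eq_empty_or_nonempty with rfl | ⟨c, hc⟩
  · exact ⟨0, 0, subsingleton_empty.monotoneOn _, subsingleton_empty.monotoneOn _,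
      eqOn_empty _ _, by simp⟩
  set V := (eVariationOn φ J).toReal
  set v := variationOnFromTo φ J c
  have hloc := hφ.locallyBoundedVariationOn
  refine ⟨fun x => v x + (V + M), fun x => (v - φ) x + (V + M),
    (variationOnFromTo.monotoneOn hloc hc).add_const _,
    (variationOnFromTo.sub_self_monotoneOn hloc hc).add_const _,
    fun x _ => by simp, fun x hx => ?_⟩
  have hv : |v x| ≤ V := variationOnFromTo.abs_le_eVariationOn hφ
  have hx := hM x hx
  rw [abs_le] at hv hx
  simp only [mem_Icc, Pi.sub_apply]
  refine ⟨⟨?_, ?_⟩, ?_, ?_⟩ <;> linarith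

lemma CdfDistLE.abs_setIntegral_sub_le_of_boundedVariationOn {μ ν : Measure ℝ}
    [IsFiniteMeasure μ] [IsFiniteMeasure ν] {c ε : ℝ} (h : CdfDistLE μ ν c ε)
    (hJ : J.OrdConnected) (hJc : J ⊆ Iic c) (hφ : BoundedVariationOn φ J)
    (hM : ∀ x ∈ J, |φ x| ≤ M) (hM0 : 0 ≤ M) :
    |∫ x in J, φ x ∂μ - ∫ x in J, φ x ∂ν| ≤ 8 * ((eVariationOn φ J).toReal + M) * ε := by
  obtain ⟨p, q, hp, hq, hpq, hbound⟩ := exists_monotoneOn_sub_of_boundedVariationOn hφ hM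
  set B := 2 * ((eVariationOn φ J).toReal + M) with hB
  have hB0 : 0 ≤ B := by positivity
  have integral_eq : ∀ (ρ : Measure ℝ) [IsFiniteMeasure ρ],
      ∫ x in J, φ x ∂ρ = ∫ x in J, p x ∂ρ - ∫ x in J, q x ∂ρ := fun ρ _ => by
    rw [setIntegral_congr_fun hJ.measurableSet hpq]
    exact integral_sub
      (integrableOn_of_quasiconcaveOn (hp.quasiconcaveOn hJ.convex) hJ
        (fun x hx => abs_le.2 ⟨(neg_nonpos.2 hB0).trans (hbound x hx).1.1, (hbound x hx).1.2⟩) ρ)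
      (integrableOn_of_quasiconcaveOn (hq.quasiconcaveOn hJ.convex) hJ
        (fun x hx => abs_le.2 ⟨(neg_nonpos.2 hB0).trans (hbound x hx).2.1, (hbound x hx).2.2⟩) ρ)
  have hp_le := h.abs_setIntegral_sub_le_of_quasiconcaveOn hJ hJc (hp.quasiconcaveOn hJ.convex)
    (fun x hx => (hbound x hx).1.1) (fun x hx => (hbound x hx).1.2) hB0
  have hq_le := h.abs_setIntegral_sub_le_of_quasiconcaveOn hJ hJc (hq.quasiconcaveOn hJ.convex)
    (fun x hx => (hbound x hx).2.1) (fun x hx => (hbound x hx).2.2) hB0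
  rw [integral_eq μ, integral_eq ν, sub_sub_sub_comm]
  calc _ ≤ 2 * ε * B + 2 * ε * B := (abs_sub _ _).trans (add_le_add hp_le hq_le)
    _ = 8 * ((eVariationOn φ J).toReal + M) * ε := by rw [hB]; ring

end BoundedVariation

section Smoothing

/-- The smoothed density `b⁻¹ ∫_a^∞ k((t - x)/b) dν(x)` of a measure `ν`; `kernelSmooth` is the
case in which `ν` is given by its distribution function. -/
noncomputable def smooth (k : ℝ → ℝ) (b a : ℝ) (ν : Measure ℝ) (t : ℝ) : ℝ :=
  b⁻¹ * ∫ x in Ici a, k ((t - x) / b) ∂ν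

variable {k : ℝ → ℝ} {r s : ℝ}

lemma exists_bound_of_boundedVariationOn_Ioo (hk : BoundedVariationOn k (Ioo r s))
    (hk0 : ∀ u ∉ Ioo r s, k u = 0) : ∃ M, ∀ u, |k u| ≤ M := by
  rcases (Ioo r s).eq_empty_or_nonempty with h | ⟨c, hc⟩
  · exact ⟨0, fun u => by simp [hk0 u (h ▸ notMem_empty u)]⟩
  refine ⟨|k c| + (eVariationOn k (Ioo r s)).toReal, fun u => ?_⟩
  by_cases hu : u ∈ Ioo r s
  · have := hk.dist_le hu hc
    rw [Real.dist_eq] at this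
    linarith [abs_sub_abs_le_abs_sub (k u) (k c)]
  · rw [hk0 u hu, abs_zero]
    positivity

lemma measurable_of_boundedVariationOn_Ioo (hk : BoundedVariationOn k (Ioo r s))
    (hk0 : ∀ u ∉ Ioo r s, k u = 0) : Measurable k := by
  obtain ⟨p, q, hp, hq, rfl, -⟩ :=
    hk.locallyBoundedVariationOn.exists_monotoneOn_sub_monotoneOn'
  have measurable_domRestrict {g : ℝ → ℝ} (hg : MonotoneOn g (Ioo r s)) :
      Measurable ((Ioo r s).domRestrict g) :=
    Monotone.measurable fun x y hxy => hg x.2 y.2 hxy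
  refine measurable_of_restrict_of_restrict_compl measurableSet_Ioo
    ((measurable_domRestrict hp).sub (measurable_domRestrict hq)) ?_
  rw [show (Ioo r s)ᶜ.domRestrict (p - q) = 0 from funext fun u => hk0 u u.2]
  exact measurable_const

/-- The bounded-variation norm of a kernel is invariant under `x ↦ (t - x) / b`, so the constant
does not depend on the bandwidth. -/
lemma exists_abs_smooth_sub_le (hk : BoundedVariationOn k (Ioo r s))
    (hk0 : ∀ u ∉ Ioo r s, k u = 0) :
    ∃ K, 0 ≤ K ∧ ∀ (μ ν : Measure ℝ) [IsFiniteMeasure μ] [IsFiniteMeasure ν] (a b c t ε : ℝ),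
      CdfDistLE μ ν c ε → 0 < b → t - r * b ≤ c →
        |smooth k b a μ t - smooth k b a ν t| ≤ K * (b⁻¹ * ε) := by
  obtain ⟨M, hM⟩ := exists_bound_of_boundedVariationOn_Ioo hk hk0
  have hM0 : 0 ≤ M := (abs_nonneg _).trans (hM 0)
  refine ⟨8 * ((eVariationOn k (Ioo r s)).toReal + M), by positivity,
    fun μ ν _ _ a b c t ε h hb htc => ?_⟩
  set A : ℝ → ℝ := fun x => (t - x) / b
  have hA : Antitone A := fun x y hxy => by simp only [A]; gcongr
  set J := Ici a ∩ A ⁻¹' Ioo r s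
  have hJ : J.OrdConnected := ordConnected_Ici.inter (ordConnected_Ioo.preimage_anti hA)
  have hJc : J ⊆ Iic c := fun x hx => by
    have : r * b < t - x := (lt_div_iff₀ hb).1 hx.2.1
    exact (show x ≤ c by linarith)
  have hvar : eVariationOn (k ∘ A) J ≤ eVariationOn k (Ioo r s) :=
    eVariationOn.comp_le_of_antitoneOn k A (hA.antitoneOn J) fun x hx => hx.2
  have setIntegral_eq (ρ : Measure ℝ) :
      ∫ x in Ici a, k ((t - x) / b) ∂ρ = ∫ x in J, (k ∘ A) x ∂ρ :=
    setIntegral_eq_of_subset_of_forall_sdiff_eq_zero (s := J) measurableSet_Ici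
      inter_subset_left (fun x hx => hk0 (A x) fun hxA => hx.2 ⟨hx.1, hxA⟩)
  have hintegral := h.abs_setIntegral_sub_le_of_boundedVariationOn hJ hJc
    (ne_top_of_le_ne_top hk hvar) (fun x _ => hM (A x)) hM0
  calc |smooth k b a μ t - smooth k b a ν t|
      = b⁻¹ * |∫ x in J, (k ∘ A) x ∂μ - ∫ x in J, (k ∘ A) x ∂ν| := by
        rw [smooth, smooth, ← mul_sub, abs_mul, abs_of_pos (inv_pos.2 hb), setIntegral_eq,
          setIntegral_eq]
    _ ≤ b⁻¹ * (8 * ((eVariationOn k (Ioo r s)).toReal + M) * ε) := by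
        have := h.nonneg
        gcongr
        exact hintegral.trans (by gcongr)
    _ = 8 * ((eVariationOn k (Ioo r s)).toReal + M) * (b⁻¹ * ε) := by ring

end Smoothing

section NegativeAssociation

variable {Ω : Type*} [MeasurableSpace Ω] {μ : Measure Ω}

lemma memLp_prod_of_mem_Icc {ι : Type*} [IsFiniteMeasure μ] {f : ι → Ω → ℝ} {C : ℝ}
    (hf : ∀ i, Measurable (f i)) (h : ∀ i ω, f i ω ∈ Icc 0 C) (s : Finset ι) (p : ENNReal) :
    MemLp (fun ω => ∏ i ∈ s, f i ω) p μ := by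
  refine MemLp.of_bound (Finset.measurable_prod _ fun i _ => hf i).aestronglyMeasurable
    (C ^ s.card) (Eventually.of_forall fun ω => ?_)
  rw [Real.norm_of_nonneg (Finset.prod_nonneg fun i _ => (h i ω).1)]
  exact (Finset.prod_le_prod (fun i _ => (h i ω).1) fun i _ => (h i ω).2).trans_eq
    (Finset.prod_const C)

variable [IsProbabilityMeasure μ]

lemma NegAssociated.integral_mul_le {Z : ℕ → Ω → ℝ} (hZ : NegAssociated μ Z) {A B : Finset ℕ}
    (hAB : Disjoint A B) {φ : (A → ℝ) → ℝ} {ψ : (B → ℝ) → ℝ} (hφ : Measurable φ)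
    (hψ : Measurable ψ) (hdir : (Monotone φ ∧ Monotone ψ) ∨ (Antitone φ ∧ Antitone ψ))
    (hφL : MemLp (fun ω => φ fun i => Z i ω) 2 μ) (hψL : MemLp (fun ω => ψ fun j => Z j ω) 2 μ) :
    ∫ ω, φ (fun i => Z i ω) * ψ (fun j => Z j ω) ∂μ ≤
      (∫ ω, φ fun i => Z i ω ∂μ) * ∫ ω, ψ fun j => Z j ω ∂μ := by
  have hcov := hZ A B hAB φ ψ hφ hψ hdir (hφL.integrable one_le_two) (hψL.integrable one_le_two)
    (hφL.integrable_mul hψL)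
  rw [covariance_eq_sub hφL hψL] at hcov
  exact sub_nonpos.1 hcov

lemma NegAssociated.integral_prod_le {Z : ℕ → Ω → ℝ} (hZ : NegAssociated μ Z)
    (hmeas : ∀ i, Measurable (Z i)) {f : ℕ → ℝ → ℝ} {C : ℝ} (hfC : ∀ i x, f i x ∈ Icc 0 C)
    (hf : (∀ i, Monotone (f i)) ∨ ∀ i, Antitone (f i)) (s : Finset ℕ) :
    ∫ ω, ∏ i ∈ s, f i (Z i ω) ∂μ ≤ ∏ i ∈ s, ∫ ω, f i (Z i ω) ∂μ := by
  have hfm (i : ℕ) : Measurable (f i) :=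
    hf.elim (fun h => (h i).measurable) fun h => (h i).measurable
  have memLp_prod (u : Finset ℕ) : MemLp (fun ω => ∏ i ∈ u, f i (Z i ω)) 2 μ :=
    memLp_prod_of_mem_Icc (fun i => (hfm i).comp (hmeas i)) (fun i ω => hfC i (Z i ω)) u 2
  have measurable_prod (u : Finset ℕ) : Measurable fun z : u → ℝ => ∏ i : u, f i (z i) :=
    Finset.measurable_prod _ fun i _ => (hfm i).comp (measurable_pi_apply i)
  have hdir (u v : Finset ℕ) :
      (Monotone (fun z : u → ℝ => ∏ i : u, f i (z i)) ∧
        Monotone fun z : v → ℝ => ∏ i : v, f i (z i)) ∨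
      (Antitone (fun z : u → ℝ => ∏ i : u, f i (z i)) ∧
        Antitone fun z : v → ℝ => ∏ i : v, f i (z i)) := by
    refine hf.imp (fun h => ⟨?_, ?_⟩) fun h => ⟨?_, ?_⟩ <;>
      exact fun x y hxy => Finset.prod_le_prod (fun i _ => (hfC _ _).1) fun i _ => h _ (hxy i)
  have prod_attach (u : Finset ℕ) (ω : Ω) :
      ∏ i : u, f i (Z i ω) = ∏ i ∈ u, f i (Z i ω) := Finset.prod_coe_sort u fun i => f i (Z i ω)
  induction s using Finset.induction_on with
  | empty => simp
  | insert j s hj ih =>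
    have hmul := hZ.integral_mul_le (Finset.disjoint_singleton_left.2 hj) (measurable_prod {j})
      (measurable_prod s) (hdir {j} s)
      (by simpa only [prod_attach] using memLp_prod {j})
      (by simpa only [prod_attach] using memLp_prod s)
    simp only [prod_attach, Finset.prod_singleton] at hmul
    simp only [Finset.prod_insert hj]
    exact hmul.trans (mul_le_mul_of_nonneg_left ih (integral_nonneg fun ω => (hfC j _).1))

end NegativeAssociation

section BiMonotone

variable {α β γ δ : Type*} [Preorder α] [Preorder β] [Preorder γ] [Preorder δ]

/-- Monotone in each of two coordinates, where the direction in one coordinate does not depend on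
the value of the other. This is the class of functions of a pair (lifetime, censoring time) to
which negative association applies; a set `S` is treated through its membership predicate. -/
structure BiMonotone (H : α × β → γ) : Prop where
  left : (∀ y, Monotone fun t => H (t, y)) ∨ ∀ y, Antitone fun t => H (t, y)
  right : (∀ t, Monotone fun y => H (t, y)) ∨ ∀ t, Antitone fun y => H (t, y)

lemma BiMonotone.monotone_comp {H : α × β → γ} (hH : BiMonotone H) {g : γ → δ}
    (hg : Monotone g) : BiMonotone (g ∘ H) where
  left := hH.left.imp (fun h y => hg.comp (h y)) fun h y => hg.comp_antitone (h y)
  right := hH.right.imp (fun h t => hg.comp (h t)) fun h t => hg.comp_antitone (h t)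

lemma BiMonotone.antitone_comp {H : α × β → γ} (hH : BiMonotone H) {g : γ → δ}
    (hg : Antitone g) : BiMonotone (g ∘ H) where
  left := hH.left.symm.imp (fun h y => hg.comp (h y)) fun h y => hg.comp_monotone (h y)
  right := hH.right.symm.imp (fun h t => hg.comp (h t)) fun h t => hg.comp_monotone (h t)

lemma BiMonotone.indicator_one {S : Set (α × β)} (hS : BiMonotone (· ∈ S)) :
    BiMonotone (S.indicator (1 : α × β → ℝ)) := by
  classical
  convert hS.monotone_comp (g := fun p : Prop => if p then (1 : ℝ) else 0) fun p q hpq => ?_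
  · ext z
    simp [indicator_apply]
  · by_cases hp : p
    · simp [hp, hpq hp]
    · by_cases hq : q <;> simp [hp, hq]

lemma BiMonotone.exp_mul {H : α × β → ℝ} (hH : BiMonotone H) (l : ℝ) :
    BiMonotone fun z => Real.exp (l * H z) := by
  rcases le_total 0 l with hl | hl
  · exact hH.monotone_comp fun x y hxy => Real.exp_le_exp.2 (mul_le_mul_of_nonneg_left hxy hl)
  · exact hH.antitone_comp fun x y hxy => Real.exp_le_exp.2 (mul_le_mul_of_nonpos_left hxy hl)

lemma BiMonotone.monotone_or_antitone_integral [MeasurableSpace α] {P : Measure α}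
    {H : α × β → ℝ} (hH : BiMonotone H) (hint : ∀ y, Integrable (fun t => H (t, y)) P) :
    Monotone (fun y => ∫ t, H (t, y) ∂P) ∨ Antitone fun y => ∫ t, H (t, y) ∂P :=
  hH.right.imp (fun h x y hxy => integral_mono (hint x) (hint y) fun t => h t hxy)
    fun h x y hxy => integral_mono (hint y) (hint x) fun t => h t hxy

end BiMonotone

section CensoredModel

variable {Ω : Type*} [MeasurableSpace Ω]

/-- Random censorship with negative dependence: negatively associated lifetimes `T` with common
law `P`, independent of negatively associated censoring times `Y` with common law `Q`. -/
structure CensoredModel (μ : Measure Ω) (T Y : ℕ → Ω → ℝ) (P Q : Measure ℝ) : Prop where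
  measurable_T : ∀ i, Measurable (T i)
  measurable_Y : ∀ i, Measurable (Y i)
  negAssociated_T : NegAssociated μ T
  negAssociated_Y : NegAssociated μ Y
  indepFun : IndepFun (fun ω i => T i ω) (fun ω i => Y i ω) μ
  map_T : ∀ i, μ.map (T i) = P
  map_Y : ∀ i, μ.map (Y i) = Q

namespace CensoredModel

variable {μ : Measure Ω} {T Y : ℕ → Ω → ℝ} {P Q : Measure ℝ}

lemma measurable_pair (h : CensoredModel μ T Y P Q) (i : ℕ) :
    Measurable fun ω => (T i ω, Y i ω) := (h.measurable_T i).prodMk (h.measurable_Y i)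

variable [IsProbabilityMeasure μ]

lemma isProbabilityMeasure_left (h : CensoredModel μ T Y P Q) : IsProbabilityMeasure P :=
  h.map_T 0 ▸ Measure.isProbabilityMeasure_map (h.measurable_T 0).aemeasurable

lemma isProbabilityMeasure_right (h : CensoredModel μ T Y P Q) : IsProbabilityMeasure Q :=
  h.map_Y 0 ▸ Measure.isProbabilityMeasure_map (h.measurable_Y 0).aemeasurable

lemma map_pair (h : CensoredModel μ T Y P Q) (i : ℕ) :
    μ.map (fun ω => (T i ω, Y i ω)) = P.prod Q := by
  have hi : IndepFun (T i) (Y i) μ :=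
    h.indepFun.comp (measurable_pi_apply i) (measurable_pi_apply i)
  rw [(indepFun_iff_map_prod_eq_prod_map_map (h.measurable_T i).aemeasurable
    (h.measurable_Y i).aemeasurable).1 hi, h.map_T, h.map_Y]

variable {H : ℝ × ℝ → ℝ} {C : ℝ}

lemma integral_prod_left_le (h : CensoredModel μ T Y P Q) (hm : Measurable H)
    (hC : ∀ z, H z ∈ Icc 0 C) (hH : BiMonotone H) (s : Finset ℕ) (y : ℕ → ℝ) :
    ∫ ω, ∏ i ∈ s, H (T i ω, y i) ∂μ ≤ ∏ i ∈ s, ∫ t, H (t, y i) ∂P := by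
  refine (h.negAssociated_T.integral_prod_le h.measurable_T (f := fun i t => H (t, y i))
    (fun i t => hC _) (hH.left.imp (fun h i => h _) fun h i => h _) s).trans_eq ?_
  refine Finset.prod_congr rfl fun i _ => ?_
  have hmy : Measurable fun t => H (t, y i) := hm.comp (by fun_prop)
  rw [← h.map_T i, integral_map (h.measurable_T i).aemeasurable hmy.aestronglyMeasurable]

lemma integral_prod_right_le (h : CensoredModel μ T Y P Q) {m : ℝ → ℝ}
    (hC : ∀ y, m y ∈ Icc 0 C) (hdir : Monotone m ∨ Antitone m) (s : Finset ℕ) :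
    ∫ ω, ∏ i ∈ s, m (Y i ω) ∂μ ≤ (∫ y, m y ∂Q) ^ s.card := by
  refine (h.negAssociated_Y.integral_prod_le h.measurable_Y (f := fun _ => m) (fun _ => hC)
    (hdir.imp (fun h _ => h) fun h _ => h) s).trans_eq (Finset.prod_eq_pow_card fun i _ => ?_)
  rw [← h.map_Y i, integral_map (h.measurable_Y i).aemeasurable
    (hdir.elim (·.measurable) (·.measurable)).aestronglyMeasurable]

/-- Negative association in `t` on the fibres over the censoring times, then negative association
of the fibre integrals, which are monotone functions of the censoring times. -/
lemma integral_prod_le (h : CensoredModel μ T Y P Q) (hm : Measurable H)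
    (hC : ∀ z, H z ∈ Icc 0 C) (hH : BiMonotone H) (s : Finset ℕ) :
    ∫ ω, ∏ i ∈ s, H (T i ω, Y i ω) ∂μ ≤ (∫ z, H z ∂(P.prod Q)) ^ s.card := by
  have := h.isProbabilityMeasure_left
  have := h.isProbabilityMeasure_right
  have hTm : Measurable fun ω i => T i ω := measurable_pi_lambda _ h.measurable_T
  have hYm : Measurable fun ω i => Y i ω := measurable_pi_lambda _ h.measurable_Y
  have := Measure.isProbabilityMeasure_map (μ := μ) hTm.aemeasurable
  have := Measure.isProbabilityMeasure_map (μ := μ) hYm.aemeasurable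
  set m : ℝ → ℝ := fun y => ∫ t, H (t, y) ∂P
  have integrable_fibre (y : ℝ) : Integrable (fun t => H (t, y)) P :=
    Integrable.of_mem_Icc 0 C (hm.comp (by fun_prop)).aemeasurable (.of_forall fun t => hC _)
  have hmC (y : ℝ) : m y ∈ Icc 0 C := ⟨integral_nonneg fun t => (hC _).1,
    (integral_mono (integrable_fibre y) (integrable_const C) fun t => (hC _).2).trans_eq (by simp)⟩
  have hmdir : Monotone m ∨ Antitone m := hH.monotone_or_antitone_integral integrable_fibre
  have hmm : Measurable m := hmdir.elim (·.measurable) (·.measurable)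
  set K : (ℕ → ℝ) × (ℕ → ℝ) → ℝ := fun z => ∏ i ∈ s, H (z.1 i, z.2 i)
  have hKm : Measurable K := Finset.measurable_prod _ fun i _ => hm.comp (by fun_prop)
  have hKint : Integrable K ((μ.map fun ω i => T i ω).prod (μ.map fun ω i => Y i ω)) :=
    (memLp_prod_of_mem_Icc (f := fun i (z : (ℕ → ℝ) × (ℕ → ℝ)) => H (z.1 i, z.2 i))
      (fun i => hm.comp (by fun_prop)) (fun i z => hC _) s 1).integrable le_rfl
  have hmint : Integrable (fun y : ℕ → ℝ => ∏ i ∈ s, m (y i)) (μ.map fun ω i => Y i ω) :=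
    (memLp_prod_of_mem_Icc (f := fun i (y : ℕ → ℝ) => m (y i))
      (fun i => hmm.comp (measurable_pi_apply i)) (fun i y => hmC _) s 1).integrable le_rfl
  calc ∫ ω, ∏ i ∈ s, H (T i ω, Y i ω) ∂μ
      = ∫ z, K z ∂(μ.map fun ω => ((fun i => T i ω), fun i => Y i ω)) := by
        rw [integral_map (hTm.prodMk hYm).aemeasurable hKm.aestronglyMeasurable]
    _ = ∫ y, ∫ t, K (t, y) ∂(μ.map fun ω i => T i ω) ∂(μ.map fun ω i => Y i ω) := by
        rw [(indepFun_iff_map_prod_eq_prod_map_map hTm.aemeasurable hYm.aemeasurable).1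
          h.indepFun, integral_prod_symm K hKint]
    _ ≤ ∫ y, ∏ i ∈ s, m (y i) ∂(μ.map fun ω i => Y i ω) :=
        integral_mono hKint.integral_prod_right hmint fun y =>
          (integral_map hTm.aemeasurable
            (hKm.comp measurable_prodMk_right).aestronglyMeasurable).trans_le
            (h.integral_prod_left_le hm hC hH s y)
    _ = ∫ ω, ∏ i ∈ s, m (Y i ω) ∂μ := integral_map hYm.aemeasurable hmint.1
    _ ≤ (∫ y, m y ∂Q) ^ s.card := h.integral_prod_right_le hmC hmdir s
    _ = (∫ z, H z ∂(P.prod Q)) ^ s.card := by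
        rw [integral_prod_symm _
          (Integrable.of_mem_Icc 0 C hm.aemeasurable (.of_forall hC))]

end CensoredModel

end CensoredModel

section EmpiricalMeasure

variable {α : Type*} [MeasurableSpace α]

/-- The empirical measure of the first `n` terms of the sequence `z`; it is `0` for `n = 0`. -/
noncomputable def empMeasure (n : ℕ) (z : ℕ → α) : Measure α :=
  (n : ENNReal)⁻¹ • ∑ i ∈ Finset.range n, Measure.dirac (z i)

lemma empMeasure_apply_le_one (n : ℕ) (z : ℕ → α) (s : Set α) : empMeasure n z s ≤ 1 := by
  refine (measure_mono (subset_univ s)).trans ?_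
  simp [empMeasure, ENNReal.inv_mul_le_one]

instance (n : ℕ) (z : ℕ → α) : IsFiniteMeasure (empMeasure n z) :=
  ⟨(empMeasure_apply_le_one n z univ).trans_lt ENNReal.one_lt_top⟩

lemma isProbabilityMeasure_empMeasure {n : ℕ} (hn : n ≠ 0) (z : ℕ → α) :
    IsProbabilityMeasure (empMeasure n z) :=
  ⟨by simp [empMeasure, ENNReal.inv_mul_cancel (Nat.cast_ne_zero.2 hn)]⟩

lemma integral_empMeasure [MeasurableSingletonClass α] (n : ℕ) (z : ℕ → α) (φ : α → ℝ) :
    ∫ x, φ x ∂empMeasure n z = (n : ℝ)⁻¹ * ∑ i ∈ Finset.range n, φ (z i) := by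
  rw [empMeasure, integral_smul_measure,
    integral_finsetSum_measure fun i _ => integrable_dirac (by simp)]
  simp

lemma empMeasure_real [MeasurableSingletonClass α] (n : ℕ) (z : ℕ → α) {s : Set α}
    (hs : MeasurableSet s) :
    (empMeasure n z).real s = (n : ℝ)⁻¹ * ∑ i ∈ Finset.range n, s.indicator 1 (z i) := by
  rw [← integral_indicator_one hs, integral_empMeasure]

end EmpiricalMeasure

section Hoeffding

variable {Ω : Type*} [MeasurableSpace Ω] {μ : Measure Ω} [IsProbabilityMeasure μ]
  {T Y : ℕ → Ω → ℝ} {P Q : Measure ℝ}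

lemma CensoredModel.hasSubgaussianMGF (h : CensoredModel μ T Y P Q) {ξ : ℝ × ℝ → ℝ} {a b : ℝ}
    (hm : Measurable ξ) (hξ : BiMonotone ξ) (hab : ∀ z, ξ z ∈ Icc a b) (n : ℕ) :
    HasSubgaussianMGF (fun ω => ∑ i ∈ Finset.range n,
      (ξ (T i ω, Y i ω) - ∫ z, ξ z ∂(P.prod Q))) (n * (‖b - a‖₊ / 2) ^ 2) μ := by
  have := h.isProbabilityMeasure_left
  have := h.isProbabilityMeasure_right
  set m := ∫ z, ξ z ∂(P.prod Q)
  set C := max |a - m| |b - m|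
  have exp_mul_sum (l : ℝ) (ω : Ω) :
      Real.exp (l * ∑ i ∈ Finset.range n, (ξ (T i ω, Y i ω) - m)) =
        ∏ i ∈ Finset.range n, Real.exp (l * (ξ (T i ω, Y i ω) - m)) := by
    rw [Finset.mul_sum, Real.exp_sum]
  have measurable_exp (l : ℝ) : Measurable fun z => Real.exp (l * (ξ z - m)) :=
    ((hm.sub_const m).const_mul l).exp
  have exp_mem (l : ℝ) (z : ℝ × ℝ) : Real.exp (l * (ξ z - m)) ∈ Icc 0 (Real.exp (|l| * C)) := by
    refine ⟨(Real.exp_pos _).le, Real.exp_le_exp.2 ((le_abs_self _).trans ?_)⟩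
    rw [abs_mul]
    exact mul_le_mul_of_nonneg_left (abs_le_max_abs_abs (sub_le_sub_right (hab z).1 m)
      (sub_le_sub_right (hab z).2 m)) (abs_nonneg l)
  refine ⟨fun l => ?_, fun l => ?_⟩
  · simp only [exp_mul_sum]
    exact (memLp_prod_of_mem_Icc (fun i => (measurable_exp l).comp (h.measurable_pair i))
      (fun i ω => exp_mem l _) _ 1).integrable le_rfl
  · have hoeffding_lemma := (hasSubgaussianMGF_of_mem_Icc (μ := P.prod Q) hm.aemeasurable
      (.of_forall hab)).mgf_le l
    have hprod := h.integral_prod_le (measurable_exp l) (exp_mem l)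
      ((hξ.monotone_comp fun x y hxy => sub_le_sub_right hxy m).exp_mul l) (Finset.range n)
    simp only [mgf, exp_mul_sum, Finset.card_range] at hoeffding_lemma hprod ⊢
    refine hprod.trans ((pow_le_pow_left₀ (integral_nonneg fun z => (Real.exp_pos _).le)
      hoeffding_lemma n).trans_eq ?_)
    rw [← Real.exp_nat_mul]
    push_cast
    ring_nf

lemma CensoredModel.measureReal_le_abs_empMeasure_sub_le (h : CensoredModel μ T Y P Q)
    {S : Set (ℝ × ℝ)} (hSm : MeasurableSet S) (hS : BiMonotone (· ∈ S)) (n : ℕ) {η : ℝ}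
    (hη : 0 ≤ η) :
    μ.real {ω | η ≤ |(empMeasure n fun i => (T i ω, Y i ω)).real S - (P.prod Q).real S|} ≤
      2 * Real.exp (-(2 * n * η ^ 2)) := by
  rcases n.eq_zero_or_pos with rfl | hn
  · simpa using measureReal_le_one.trans one_le_two
  have hn' : (0 : ℝ) < n := Nat.cast_pos.2 hn
  set ξ : ℝ × ℝ → ℝ := S.indicator 1
  set X : Ω → ℝ := fun ω => ∑ i ∈ Finset.range n, (ξ (T i ω, Y i ω) - ∫ z, ξ z ∂(P.prod Q))
  have hX : HasSubgaussianMGF X _ μ :=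
    h.hasSubgaussianMGF (a := 0) (b := 1) (measurable_one.indicator hSm) hS.indicator_one
      (fun z => ⟨indicator_nonneg (fun _ _ => zero_le_one) z,
        indicator_le_self' (fun _ _ => zero_le_one) z⟩) n
  have X_eq (ω : Ω) :
      X ω = n * ((empMeasure n fun i => (T i ω, Y i ω)).real S - (P.prod Q).real S) := by
    rw [empMeasure_real _ _ hSm, mul_sub, mul_inv_cancel_left₀ hn'.ne']
    simp [X, ξ, integral_indicator_one hSm]
  have hsub : {ω | η ≤ |(empMeasure n fun i => (T i ω, Y i ω)).real S - (P.prod Q).real S|} ⊆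
      {ω | n * η ≤ X ω} ∪ {ω | n * η ≤ (-X) ω} := fun ω hω => by
    simp only [mem_union, mem_ofPred_eq, Pi.neg_apply, X_eq, ← mul_neg, mul_le_mul_iff_right₀ hn']
    exact le_abs.1 hω
  have hexp : -(n * η) ^ 2 / (2 * ((n * (‖(1 : ℝ) - 0‖₊ / 2) ^ 2 : NNReal) : ℝ)) =
      -(2 * n * η ^ 2) := by
    simp only [NNReal.coe_mul, NNReal.coe_natCast, NNReal.coe_pow, NNReal.coe_div, coe_nnnorm,
      NNReal.coe_ofNat, sub_zero, norm_one]
    field_simp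
  calc _ ≤ μ.real {ω | n * η ≤ X ω} + μ.real {ω | n * η ≤ (-X) ω} :=
        (measureReal_mono hsub).trans (measureReal_union_le _ _)
    _ ≤ _ + _ :=
        add_le_add (hX.measure_ge_le (by positivity)) (hX.neg.measure_ge_le (by positivity))
    _ = 2 * Real.exp (-(2 * n * η ^ 2)) := by rw [hexp, ← two_mul]

end Hoeffding

section SubLaw

/-- The law of `V` restricted to the event `D`, under the law `π` of a pair: a subprobability
measure when `π` is a probability measure. With `π` the empirical measure this is the measure of
an empirical subdistribution function. -/
noncomputable def subLaw (π : Measure (ℝ × ℝ)) (D : Set (ℝ × ℝ)) (V : ℝ × ℝ → ℝ) : Measure ℝ :=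
  (π.restrict D).map V

variable {π : Measure (ℝ × ℝ)} {D : Set (ℝ × ℝ)} {V : ℝ × ℝ → ℝ}

instance [IsFiniteMeasure π] : IsFiniteMeasure (subLaw π D V) := by
  unfold subLaw
  infer_instance

lemma subLaw_real (hV : Measurable V) {A : Set ℝ} (hA : MeasurableSet A) :
    (subLaw π D V).real A = π.real (V ⁻¹' A ∩ D) := by
  rw [subLaw, map_measureReal_apply hV hA, measureReal_restrict_apply (hV hA)]

lemma integral_subLaw (hD : MeasurableSet D) (hV : Measurable V) {φ : ℝ → ℝ} (hφ : Measurable φ) :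
    ∫ x, φ x ∂subLaw π D V = ∫ z, D.indicator (fun z => φ (V z)) z ∂π := by
  rw [subLaw, integral_map hV.aemeasurable hφ.aestronglyMeasurable, integral_indicator hD]

open Classical in
lemma subLaw_empMeasure_real (hD : MeasurableSet D) (hV : Measurable V) (n : ℕ) (z : ℕ → ℝ × ℝ)
    {A : Set ℝ} (hA : MeasurableSet A) :
    (subLaw (empMeasure n z) D V).real A =
      (n : ℝ)⁻¹ * ((Finset.range n).filter fun i => V (z i) ∈ A ∧ z i ∈ D).card := by
  rw [subLaw_real hV hA, empMeasure_real _ _ ((hV hA).inter hD), Finset.card_filter]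
  push_cast
  simp only [indicator_apply, mem_inter_iff, mem_preimage, Pi.one_apply]

lemma tendsto_empCDF_atBot (n : ℕ) (x : ℕ → ℝ) (δ : ℕ → Prop) :
    Tendsto (empCDF n x δ) atBot (𝓝 0) := by
  classical
  refine tendsto_const_nhds.congr' ?_
  filter_upwards [(eventually_all_finset (Finset.range n)).2 fun i _ =>
    eventually_lt_atBot (x i)] with t ht
  have : events n x δ t = 0 :=
    Finset.card_eq_zero.2 (Finset.filter_eq_empty_iff.2 fun i hi h => (ht i hi).not_ge h.1)
  simp [empCDF, this]

lemma measure_empCDF (hD : MeasurableSet D) (hV : Measurable V) (n : ℕ) (z : ℕ → ℝ × ℝ) :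
    (empCDF n (fun i => V (z i)) fun i => z i ∈ D).measure = subLaw (empMeasure n z) D V := by
  classical
  refine (Measure.ext_of_Iic _ _ fun t => ?_).symm
  rw [StieltjesFunction.measure_Iic _ (tendsto_empCDF_atBot n _ _), sub_zero,
    ← ofReal_measureReal, subLaw_empMeasure_real hD hV n z measurableSet_Iic]
  simp [empCDF, events]

lemma subLaw_empMeasure_real_singleton (hD : MeasurableSet D) (hV : Measurable V) (n : ℕ)
    (z : ℕ → ℝ × ℝ) (t : ℝ) :
    (subLaw (empMeasure n z) D V).real {t} =
      (n : ℝ)⁻¹ * eventJump n (fun i => V (z i)) (fun i => z i ∈ D) t := by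
  classical
  rw [subLaw_empMeasure_real hD hV n z (measurableSet_singleton t)]
  simp only [eventJump, mem_singleton_iff]

lemma subLaw_empMeasure_univ_real_Ici (hV : Measurable V) (n : ℕ) (z : ℕ → ℝ × ℝ) (t : ℝ) :
    (subLaw (empMeasure n z) univ V).real (Ici t) =
      (n : ℝ)⁻¹ * atRisk n (fun i => V (z i)) t := by
  classical
  rw [subLaw_empMeasure_real .univ hV n z measurableSet_Ici]
  simp only [atRisk, mem_Ici, mem_univ, and_true]

open Classical in
lemma sum_eventJump_mul (n : ℕ) (x : ℕ → ℝ) (δ : ℕ → Prop) (g : ℝ → ℝ)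
    (t : ℝ) :
    ∑ s ∈ ((Finset.range n).image x).filter (· ≤ t), eventJump n x δ s * g s =
      ∑ i ∈ (Finset.range n).filter fun i => x i ≤ t ∧ δ i, g (x i) := by
  have hmaps : ∀ i ∈ (Finset.range n).filter fun i => x i ≤ t ∧ δ i,
      x i ∈ ((Finset.range n).image x).filter (· ≤ t) := fun i hi => by
    rw [Finset.mem_filter] at hi ⊢
    exact ⟨Finset.mem_image_of_mem x hi.1, hi.2.1⟩
  rw [← Finset.sum_fiberwise_of_maps_to hmaps]
  refine Finset.sum_congr rfl fun s hs => ?_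
  have hst : s ≤ t := (Finset.mem_filter.1 hs).2
  rw [Finset.sum_congr rfl fun i hi => congrArg g (Finset.mem_filter.1 hi).2, Finset.sum_const,
    nsmul_eq_mul, eventJump, Finset.filter_filter]
  congr 3
  ext i
  grind

open Classical in
lemma setIntegral_Iic_subLaw_empMeasure (hD : MeasurableSet D) (hV : Measurable V) (n : ℕ)
    (z : ℕ → ℝ × ℝ) {g : ℝ → ℝ} (hg : Measurable g) (t : ℝ) :
    ∫ s in Iic t, g s ∂subLaw (empMeasure n z) D V =
      (n : ℝ)⁻¹ * ∑ s ∈ ((Finset.range n).image fun i => V (z i)).filter (· ≤ t),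
        eventJump n (fun i => V (z i)) (fun i => z i ∈ D) s * g s := by
  rw [← integral_indicator measurableSet_Iic,
    integral_subLaw hD hV (hg.indicator measurableSet_Iic), integral_empMeasure,
    sum_eventJump_mul, Finset.sum_filter]
  refine congrArg _ (Finset.sum_congr rfl fun i _ => ?_)
  simp only [indicator_apply, mem_Iic]
  split_ifs <;> tauto

end SubLaw

section Quantile

lemma tendsto_measureReal_Iic_atBot (ν : Measure ℝ) [IsFiniteMeasure ν] :
    Tendsto (fun x => ν.real (Iic x)) atBot (𝓝 0) := by
  have h := tendsto_measure_iInter_atBot (μ := ν) (fun x => measurableSet_Iic.nullMeasurableSet)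
    (monotone_Iic (α := ℝ)) ⟨0, measure_ne_top _ _⟩
  rw [iInter_Iic_eq_empty_iff.2 (by simp), measure_empty] at h
  exact (ENNReal.tendsto_toReal ENNReal.zero_ne_top).comp h

lemma tendsto_measureReal_Iic_nhdsGT (ν : Measure ℝ) [IsFiniteMeasure ν] (a : ℝ) :
    Tendsto (fun x => ν.real (Iic x)) (𝓝[>] a) (𝓝 (ν.real (Iic a))) := by
  have h := tendsto_measure_biInter_gt (μ := ν) (s := Iic) (a := a)
    (fun x _ => measurableSet_Iic.nullMeasurableSet) (fun i j _ hij => Iic_subset_Iic.2 hij)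
    ⟨a + 1, lt_add_one a, measure_ne_top _ _⟩
  have hInter : ⋂ x > a, Iic x = Iic a := by
    ext x
    simpa only [mem_iInter, mem_Iic] using
      ⟨le_of_forall_gt_imp_ge_of_dense, fun h y hy => h.trans hy.le⟩
  rw [hInter] at h
  exact (ENNReal.tendsto_toReal (measure_ne_top _ _)).comp h

/-- The quantile of order `q` of a finite measure on the line. The infimum is meaningful only
when `0 < q` and `q` does not exceed the mass of some half-line `Iic x`. -/
noncomputable def quantile (ν : Measure ℝ) (q : ℝ) : ℝ := sInf {x | q ≤ ν.real (Iic x)}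

variable {ρ ν : Measure ℝ} [IsFiniteMeasure ν] {q : ℝ}

lemma bddBelow_setOf_le_measureReal_Iic (hq : 0 < q) : BddBelow {x | q ≤ ν.real (Iic x)} := by
  obtain ⟨y, hy⟩ := ((tendsto_measureReal_Iic_atBot ν).eventually (gt_mem_nhds hq)).exists
  refine ⟨y, fun x (hx : q ≤ ν.real (Iic x)) => le_of_not_gt fun hxy => hy.not_ge ?_⟩
  exact hx.trans (measureReal_mono (Iic_subset_Iic.2 hxy.le))

lemma le_measureReal_Iic_quantile (hne : {x | q ≤ ν.real (Iic x)}.Nonempty) :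
    q ≤ ν.real (Iic (quantile ν q)) := by
  refine ge_of_tendsto (tendsto_measureReal_Iic_nhdsGT ν _) ?_
  filter_upwards [self_mem_nhdsWithin] with x hx
  obtain ⟨y, hy, hyx⟩ := exists_lt_of_csInf_lt hne hx
  exact le_trans hy (measureReal_mono (Iic_subset_Iic.2 hyx.le))

lemma measureReal_Iio_quantile_le (hq : 0 < q) : ν.real (Iio (quantile ν q)) ≤ q := by
  obtain ⟨u, hu, hlt, hlim⟩ := exists_seq_strictMono_tendsto (quantile ν q)
  refine le_of_tendsto' (tendsto_measureReal_Iic_of_strictMono ν hu hlt hlim) fun n => ?_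
  by_contra! hn
  exact (hlt n).not_ge (csInf_le (bddBelow_setOf_le_measureReal_Iic hq) hn.le)

lemma exists_div_le_lt_div {m : ℕ} (hm : 0 < m) {c : ℝ} (hc : c ∈ Icc 0 1) :
    ∃ j ≤ m, (j : ℝ) / m ≤ c ∧ c < (j + 1 : ℕ) / m := by
  have hm' : (0 : ℝ) < m := Nat.cast_pos.2 hm
  refine ⟨⌊c * m⌋₊, Nat.floor_le_of_le (mul_le_of_le_one_left hm'.le hc.2), ?_, ?_⟩
  · exact (div_le_iff₀ hm').2 (Nat.floor_le (mul_nonneg hc.1 hm'.le))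
  · rw [lt_div_iff₀ hm', Nat.cast_succ]
    exact Nat.lt_floor_add_one _

variable {m : ℕ} {ε : ℝ}

lemma measureReal_Iic_mem_Icc (hν : ν.real univ ≤ 1) (x : ℝ) : ν.real (Iic x) ∈ Icc 0 1 :=
  ⟨measureReal_nonneg, (measureReal_mono (subset_univ _)).trans hν⟩

lemma measureReal_Iic_le_of_quantile [IsFiniteMeasure ρ] (hm : 0 < m) (hν : ν.real univ ≤ 1)
    (hε : 0 ≤ ε)
    (h : ∀ j ≤ m, ν.real (Iic (quantile ν (j / m))) ≤ ρ.real (Iic (quantile ν (j / m))) + ε)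
    (x : ℝ) : ν.real (Iic x) ≤ ρ.real (Iic x) + (ε + 1 / m) := by
  obtain ⟨j, hjm, hjle, hjlt⟩ := exists_div_le_lt_div hm (measureReal_Iic_mem_Icc hν x)
  rw [Nat.cast_succ, add_div] at hjlt
  rcases j.eq_zero_or_pos with rfl | hj
  · simp only [CharP.cast_eq_zero, zero_div, zero_add] at hjlt
    linarith [measureReal_nonneg (μ := ρ) (s := Iic x)]
  · have hmem : x ∈ {x | (j : ℝ) / m ≤ ν.real (Iic x)} := hjle
    have hqx : quantile ν (j / m) ≤ x :=
      csInf_le (bddBelow_setOf_le_measureReal_Iic (by positivity)) hmem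
    have hq := le_measureReal_Iic_quantile ⟨x, hmem⟩
    linarith [h j hjm, measureReal_mono (μ := ρ) (Iic_subset_Iic.2 hqx)]

lemma measureReal_Iic_le_add_of_quantile [IsFiniteMeasure ρ] (hm : 0 < m) (hν : ν.real univ ≤ 1)
    (h : ∀ j ≤ m, ρ.real (Iio (quantile ν (j / m))) ≤ ν.real (Iio (quantile ν (j / m))) + ε)
    (huniv : ρ.real univ ≤ ν.real univ + ε) (x : ℝ) :
    ρ.real (Iic x) ≤ ν.real (Iic x) + (ε + 1 / m) := by
  obtain ⟨j, -, hjle, hjlt⟩ := exists_div_le_lt_div hm (measureReal_Iic_mem_Icc hν x)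
  set q : ℝ := (j + 1 : ℕ) / m
  have hm' : (0 : ℝ) < m := Nat.cast_pos.2 hm
  have hq : 0 < q := by positivity
  have hqx : q ≤ ν.real (Iic x) + 1 / m := by
    rw [show q = j / m + 1 / m by rw [← add_div, ← Nat.cast_succ]]
    gcongr
  rcases {y | q ≤ ν.real (Iic y)}.eq_empty_or_nonempty with hempty | hne
  · have hνq : ν.real univ ≤ q :=
      le_of_tendsto' ((ENNReal.tendsto_toReal (measure_ne_top ν univ)).comp
        (tendsto_measure_Iic_atTop ν)) fun y => le_of_not_ge fun hy =>
          (eq_empty_iff_forall_notMem.1 hempty y) hy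
    linarith [measureReal_mono (μ := ρ) (subset_univ (Iic x))]
  · have hle := le_measureReal_Iic_quantile hne
    have hjm : j + 1 ≤ m := by
      have := hle.trans (measureReal_Iic_mem_Icc hν _).2
      exact_mod_cast (div_le_one hm').1 this
    have hlt : x < quantile ν q := by
      by_contra! hx
      exact (hle.trans (measureReal_mono (Iic_subset_Iic.2 hx))).not_gt hjlt
    linarith [h (j + 1) hjm, measureReal_Iio_quantile_le (ν := ν) hq,
      measureReal_mono (μ := ρ) (Iic_subset_Iio.2 hlt)]

lemma cdfDistLE_of_quantile [IsFiniteMeasure ρ] (hm : 0 < m) (hν : ν.real univ ≤ 1)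
    (hIic : ∀ j ≤ m,
      |ρ.real (Iic (quantile ν (j / m))) - ν.real (Iic (quantile ν (j / m)))| ≤ ε)
    (hIio : ∀ j ≤ m,
      |ρ.real (Iio (quantile ν (j / m))) - ν.real (Iio (quantile ν (j / m)))| ≤ ε)
    (huniv : |ρ.real univ - ν.real univ| ≤ ε) (c : ℝ) : CdfDistLE ρ ν c (ε + 1 / m) := by
  simp only [abs_sub_le_iff, sub_le_iff_le_add'] at hIic hIio huniv
  refine fun x _ => abs_sub_le_iff.2 ⟨sub_le_iff_le_add'.2 ?_, sub_le_iff_le_add'.2 ?_⟩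
  · exact measureReal_Iic_le_add_of_quantile hm hν (fun j hj => (hIio j hj).1) huniv.1 x
  · have hε : 0 ≤ ε := by linarith [huniv.1, huniv.2]
    exact measureReal_Iic_le_of_quantile hm hν hε (fun j hj => (hIic j hj).2) x

end Quantile

section GlivenkoCantelli

/-- The rate `(log n / n)^{1/2}`. -/
noncomputable def rate (n : ℕ) : ℝ := Real.sqrt (Real.log n / n)

lemma rate_nonneg (n : ℕ) : 0 ≤ rate n := Real.sqrt_nonneg _

lemma rate_sq (n : ℕ) : rate n ^ 2 = Real.log n / n :=
  Real.sq_sqrt (div_nonneg (Real.log_natCast_nonneg n) (Nat.cast_nonneg n))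

lemma one_div_le_rate {n : ℕ} (hn : 2 ≤ n) : 1 / (n : ℝ) ≤ rate n := by
  have hn' : (2 : ℝ) ≤ n := Nat.ofNat_le_cast.2 hn
  have hlog : 1 / (n : ℝ) ≤ Real.log n :=
    calc 1 / (n : ℝ) ≤ 1 - (n : ℝ)⁻¹ := by
          have := inv_anti₀ two_pos hn'
          rw [one_div]
          linarith
      _ ≤ Real.log n := Real.one_sub_inv_le_log_of_pos (by linarith)
  refine Real.le_sqrt_of_sq_le ?_
  rw [sq, ← div_eq_mul_one_div]
  gcongr

lemma tendsto_rate : Tendsto rate atTop (𝓝 0) := by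
  have h : Tendsto (fun n : ℕ => Real.log n / n) atTop (𝓝 0) :=
    Real.isLittleO_log_id_atTop.tendsto_div_nhds_zero.comp tendsto_natCast_atTop_atTop
  have h' := (Real.continuous_sqrt.tendsto 0).comp h
  rwa [Real.sqrt_zero] at h'

lemma exp_neg_two_mul_two_mul_rate_sq {n : ℕ} (hn : 0 < n) :
    Real.exp (-(2 * n * (2 * rate n) ^ 2)) = 1 / (n : ℝ) ^ 8 := by
  have hn' : (0 : ℝ) < n := Nat.cast_pos.2 hn
  have : -(2 * (n : ℝ) * (2 * rate n) ^ 2) = -((8 : ℕ) * Real.log n) := by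
    rw [mul_pow, rate_sq]
    field_simp
    norm_num [mul_comm]
  rw [this, Real.exp_neg, Real.exp_nat_mul, Real.exp_log hn', one_div]

variable {Ω : Type*} [MeasurableSpace Ω] {μ : Measure Ω} [IsProbabilityMeasure μ]
  {T Y : ℕ → Ω → ℝ} {P Q : Measure ℝ}

lemma CensoredModel.measureReal_iUnion_le (h : CensoredModel μ T Y P Q) {S : ℕ → Set (ℝ × ℝ)}
    (hSm : ∀ j, MeasurableSet (S j)) (hS : ∀ j, BiMonotone (· ∈ S j)) {n : ℕ} (hn : 0 < n) :
    μ.real (⋃ j ∈ Finset.range (n + 1), {ω | 2 * rate n ≤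
      |(empMeasure n fun i => (T i ω, Y i ω)).real (S j) - (P.prod Q).real (S j)|}) ≤
      4 * (1 / (n : ℝ) ^ 2) := by
  have hn' : (1 : ℝ) ≤ n := Nat.one_le_cast.2 hn
  refine (measureReal_biUnion_finset_le _ _).trans ((Finset.sum_le_card_nsmul _ _ _ fun j _ =>
    h.measureReal_le_abs_empMeasure_sub_le (hSm j) (hS j) n
      (mul_nonneg zero_le_two (rate_nonneg n))).trans ?_)
  rw [exp_neg_two_mul_two_mul_rate_sq hn, Finset.card_range, nsmul_eq_mul, Nat.cast_succ]
  calc ((n : ℝ) + 1) * (2 * (1 / (n : ℝ) ^ 8)) ≤ (n + n) * (2 * (1 / (n : ℝ) ^ 8)) := by gcongr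
    _ = 4 * (1 / (n : ℝ) ^ 7) := by
      field_simp
      norm_num
    _ ≤ 4 * (1 / (n : ℝ) ^ 2) := by
      gcongr ?_ * (1 / ?_)
      exact pow_le_pow_right₀ hn' (by norm_num)

lemma CensoredModel.ae_eventually_forall_abs_empMeasure_sub_le (h : CensoredModel μ T Y P Q)
    {S : ℕ → ℕ → Set (ℝ × ℝ)} (hSm : ∀ n j, MeasurableSet (S n j))
    (hS : ∀ n j, BiMonotone (· ∈ S n j)) :
    ∀ᵐ ω ∂μ, ∀ᶠ n in atTop, ∀ j ≤ n,
      |(empMeasure n fun i => (T i ω, Y i ω)).real (S n j) - (P.prod Q).real (S n j)| ≤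
        2 * rate n := by
  set B : ℕ → Set Ω := fun n => ⋃ j ∈ Finset.range (n + 1), {ω | 2 * rate n ≤
    |(empMeasure n fun i => (T i ω, Y i ω)).real (S n j) - (P.prod Q).real (S n j)|}
  have hsum : Summable fun n => μ.real (B n) := by
    refine .of_norm_bounded_eventually_nat
      ((Real.summable_one_div_nat_pow.2 one_lt_two).mul_left 4) ?_
    filter_upwards [eventually_gt_atTop 0] with n hn
    rw [Real.norm_of_nonneg measureReal_nonneg]
    exact h.measureReal_iUnion_le (hSm n) (hS n) hn
  have htsum : ∑' n, μ (B n) ≠ ⊤ :=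
    (tsum_congr fun n => ofReal_measureReal (measure_ne_top μ (B n))) ▸ hsum.tsum_ofReal_ne_top
  filter_upwards [ae_eventually_notMem htsum] with ω hω
  filter_upwards [hω] with n hn j hj
  by_contra! hlt
  exact hn (mem_biUnion (Finset.mem_range_succ_iff.2 hj) hlt.le)

lemma CensoredModel.ae_eventually_forall_cdfDistLE (h : CensoredModel μ T Y P Q)
    {D : Set (ℝ × ℝ)} {V : ℝ × ℝ → ℝ} (hD : MeasurableSet D) (hV : Measurable V)
    (hVD : ∀ A, IsLowerSet A → BiMonotone (· ∈ V ⁻¹' A ∩ D)) :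
    ∀ᵐ ω ∂μ, ∀ᶠ n in atTop, ∀ c, CdfDistLE (subLaw (empMeasure n fun i => (T i ω, Y i ω)) D V)
      (subLaw (P.prod Q) D V) c (3 * rate n) := by
  have := h.isProbabilityMeasure_left
  have := h.isProbabilityMeasure_right
  set ν := subLaw (P.prod Q) D V with hν
  have close (A : ℕ → ℕ → Set ℝ) (hA : ∀ n j, IsLowerSet (A n j)) :
      ∀ᵐ ω ∂μ, ∀ᶠ n in atTop, ∀ j ≤ n,
        |(subLaw (empMeasure n fun i => (T i ω, Y i ω)) D V).real (A n j) - ν.real (A n j)| ≤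
          2 * rate n := by
    have hAm n j := (hA n j).ordConnected.measurableSet
    simpa only [hν, subLaw_real hV (hAm _ _)] using
      h.ae_eventually_forall_abs_empMeasure_sub_le (S := fun n j => V ⁻¹' A n j ∩ D)
        (fun n j => (hV (hAm n j)).inter hD) fun n j => hVD _ (hA n j)
  filter_upwards [close (fun n j => Iic (quantile ν (j / n))) fun _ _ => isLowerSet_Iic _,
    close (fun n j => Iio (quantile ν (j / n))) fun _ _ => isLowerSet_Iio _,
    close (fun _ _ => univ) fun _ _ => isLowerSet_univ] with ω hIic hIio huniv
  filter_upwards [hIic, hIio, huniv, eventually_ge_atTop 2] with n hIic hIio huniv hn c x hx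
  have hν1 : ν.real univ ≤ 1 := (subLaw_real hV .univ).trans_le measureReal_le_one
  exact (cdfDistLE_of_quantile (by lia) hν1 hIic hIio (huniv 0 n.zero_le) c x hx).trans
    (by linarith [one_div_le_rate hn])

end GlivenkoCantelli

section IntegralTransform

lemma quantile_le_iff {ν : Measure ℝ} [IsFiniteMeasure ν] {q x : ℝ} (hq : 0 < q)
    (hne : {x | q ≤ ν.real (Iic x)}.Nonempty) : quantile ν q ≤ x ↔ q ≤ ν.real (Iic x) :=
  ⟨fun h => (le_measureReal_Iic_quantile hne).trans (measureReal_mono (Iic_subset_Iic.2 h)),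
    csInf_le (bddBelow_setOf_le_measureReal_Iic hq)⟩

lemma measureReal_Iio_quantile {ν : Measure ℝ} [IsFiniteMeasure ν] [NullSingletonClass ν] {q : ℝ}
    (hq : 0 < q) (hne : {x | q ≤ ν.real (Iic x)}.Nonempty) : ν.real (Iio (quantile ν q)) = q :=
  (measureReal_Iio_quantile_le hq).antisymm
    ((le_measureReal_Iic_quantile hne).trans_eq (measureReal_congr Iio_ae_eq_Iic.symm))

lemma monotone_measureReal_Iic (ν : Measure ℝ) [IsFiniteMeasure ν] :
    Monotone fun x => ν.real (Iic x) :=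
  fun _ _ h => measureReal_mono (Iic_subset_Iic.2 h)

lemma measureReal_setOf_le_measureReal_Iic_inter_Iic {P : Measure ℝ} [IsFiniteMeasure P]
    [NullSingletonClass P] {t u : ℝ} (hu : 0 < u) (hut : u ≤ P.real (Iic t)) :
    P.real ({x | u ≤ P.real (Iic x)} ∩ Iic t) = P.real (Iic t) - u := by
  have hne : {x | u ≤ P.real (Iic x)}.Nonempty := ⟨t, hut⟩
  have hsplit : {x | u ≤ P.real (Iic x)} ∩ Iic t = Iic t \ Iio (quantile P u) := by
    ext x
    simp only [mem_inter_iff, mem_ofPred_eq, Set.mem_sdiff, mem_Iio, not_lt, quantile_le_iff hu hne,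
      and_comm]
  rw [hsplit, measureReal_sdiff (Iio_subset_Iic ((quantile_le_iff hu hne).2 hut))
    measurableSet_Iio, measureReal_Iio_quantile hu hne]

lemma map_restrict_Iic_measureReal_Iic (P : Measure ℝ) [IsFiniteMeasure P] [NullSingletonClass P]
    (t : ℝ) :
    (P.restrict (Iic t)).map (fun x => P.real (Iic x)) =
      volume.restrict (Ioc 0 (P.real (Iic t))) := by
  have hmono := monotone_measureReal_Iic P
  refine Measure.ext_of_Ici _ _ fun u => ?_
  rw [Measure.map_apply hmono.measurable measurableSet_Ici,
    Measure.restrict_apply (hmono.measurable measurableSet_Ici),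
    Measure.restrict_apply measurableSet_Ici]
  change P ({x | u ≤ P.real (Iic x)} ∩ Iic t) = _
  rcases le_or_gt u 0 with hu | hu
  · have hl : {x | u ≤ P.real (Iic x)} = univ :=
      eq_univ_of_forall fun x => hu.trans measureReal_nonneg
    have hr : Ioc 0 (P.real (Iic t)) ⊆ Ici u := fun x hx => hu.trans hx.1.le
    rw [hl, univ_inter, inter_eq_right.2 hr, Real.volume_Ioc, sub_zero, ofReal_measureReal]
  · have hr : Ici u ∩ Ioc 0 (P.real (Iic t)) = Icc u (P.real (Iic t)) := by
      ext x
      exact ⟨fun h => ⟨h.1, h.2.2⟩, fun h => ⟨h.1, hu.trans_le h.1, h.2⟩⟩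
    rw [hr, Real.volume_Icc]
    rcases le_or_gt u (P.real (Iic t)) with hut | hut
    · rw [← measureReal_setOf_le_measureReal_Iic_inter_Iic hu hut, ofReal_measureReal]
    · have hl : {x | u ≤ P.real (Iic x)} ∩ Iic t = ∅ :=
        disjoint_iff_inter_eq_empty.1 (disjoint_left.2 fun x hx hxt =>
          (hx.trans (hmono hxt)).not_gt hut)
      rw [hl, measure_empty, ENNReal.ofReal_of_nonpos (sub_nonpos.2 hut.le)]

lemma setIntegral_Iic_inv_measureReal_Ici {P : Measure ℝ} [IsProbabilityMeasure P]
    [NullSingletonClass P] {t : ℝ} (ht : 0 < P.real (Ioi t)) :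
    ∫ x in Iic t, (P.real (Ici x))⁻¹ ∂P = -Real.log (P.real (Ioi t)) := by
  have hIoi (x : ℝ) : P.real (Ioi x) = 1 - P.real (Iic x) := by
    rw [← compl_Iic, probReal_compl_eq_one_sub measurableSet_Iic]
  have hIci (x : ℝ) : P.real (Ici x) = 1 - P.real (Iic x) :=
    (measureReal_congr Ioi_ae_eq_Ici).symm.trans (hIoi x)
  rw [hIoi] at ht ⊢
  calc ∫ x in Iic t, (P.real (Ici x))⁻¹ ∂P
      = ∫ u in Ioc 0 (P.real (Iic t)), (1 - u)⁻¹ := by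
        simp only [hIci]
        rw [← map_restrict_Iic_measureReal_Iic P t,
          integral_map (f := fun u => (1 - u)⁻¹)
            (monotone_measureReal_Iic P).measurable.aemeasurable
            (measurable_id.const_sub 1).inv.aestronglyMeasurable]
    _ = ∫ u in (1 - P.real (Iic t))..1, u⁻¹ := by
        rw [← intervalIntegral.integral_of_le measureReal_nonneg,
          intervalIntegral.integral_comp_sub_left fun u => u⁻¹, sub_zero]
    _ = -Real.log (1 - P.real (Iic t)) := by
        rw [integral_inv (notMem_uIcc_of_lt ht one_pos), one_div, Real.log_inv]

end IntegralTransform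

section ProductLimit

lemma abs_prod_sub_prod_le {ι : Type*} (S : Finset ι) {a b : ι → ℝ}
    (ha : ∀ i ∈ S, a i ∈ Icc 0 1) (hb : ∀ i ∈ S, b i ∈ Icc 0 1) :
    |∏ i ∈ S, a i - ∏ i ∈ S, b i| ≤ ∑ i ∈ S, |a i - b i| := by
  induction S using Finset.cons_induction with
  | empty => simp
  | cons i S hi ih =>
    simp only [Finset.forall_mem_cons] at ha hb
    have hA : |∏ j ∈ S, a j| ≤ 1 :=
      (abs_of_nonneg (Finset.prod_nonneg fun j hj => (ha.2 j hj).1)).trans_le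
        (Finset.prod_le_one (fun j hj => (ha.2 j hj).1) fun j hj => (ha.2 j hj).2)
    have hbi : |b i| ≤ 1 := (abs_of_nonneg hb.1.1).trans_le hb.1.2
    rw [Finset.prod_cons, Finset.prod_cons, Finset.sum_cons]
    calc |a i * ∏ j ∈ S, a j - b i * ∏ j ∈ S, b j|
        = |(a i - b i) * ∏ j ∈ S, a j + b i * (∏ j ∈ S, a j - ∏ j ∈ S, b j)| := by ring_nf
      _ ≤ |a i - b i| * |∏ j ∈ S, a j| + |b i| * |∏ j ∈ S, a j - ∏ j ∈ S, b j| := by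
          rw [← abs_mul, ← abs_mul]
          exact abs_add_le _ _
      _ ≤ |a i - b i| + ∑ j ∈ S, |a j - b j| :=
          add_le_add (mul_le_of_le_one_right (abs_nonneg _) hA)
            ((mul_le_of_le_one_left (abs_nonneg _) hbi).trans (ih ha.2 hb.2))

lemma abs_prod_one_sub_sub_exp_le {ι : Type*} (S : Finset ι) {d : ι → ℝ} {η : ℝ}
    (hd : ∀ i ∈ S, d i ∈ Icc 0 1) (hη : ∀ i ∈ S, d i ≤ η) :
    |∏ i ∈ S, (1 - d i) - Real.exp (-∑ i ∈ S, d i)| ≤ η * ∑ i ∈ S, d i := by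
  rw [← Finset.sum_neg_distrib, Real.exp_sum, Finset.mul_sum]
  refine (abs_prod_sub_prod_le S
    (fun i hi => ⟨sub_nonneg.2 (hd i hi).2, sub_le_self 1 (hd i hi).1⟩)
    fun i hi => ⟨(Real.exp_pos _).le, Real.exp_le_one_iff.2 (neg_nonpos.2 (hd i hi).1)⟩).trans
    (Finset.sum_le_sum fun i hi => ?_)
  obtain ⟨h0, h1⟩ := hd i hi
  calc |1 - d i - Real.exp (-d i)| = |Real.exp (-d i) - 1 - -d i| := by
        rw [abs_sub_comm]
        ring_nf
    _ ≤ (-d i) ^ 2 := Real.abs_exp_sub_one_sub_id_le (by rwa [abs_neg, abs_of_nonneg h0])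
    _ = d i * d i := by ring
    _ ≤ η * d i := mul_le_mul_of_nonneg_right (hη i hi) h0

lemma abs_exp_neg_sub_exp_neg_le {x y : ℝ} (hx : 0 ≤ x) (hy : 0 ≤ y) :
    |Real.exp (-x) - Real.exp (-y)| ≤ |x - y| := by
  wlog hxy : x ≤ y generalizing x y
  · rw [abs_sub_comm, abs_sub_comm x]
    exact this hy hx (not_le.1 hxy).le
  have hfactor : Real.exp (-x) - Real.exp (-y) = Real.exp (-x) * (1 - Real.exp (x - y)) := by
    rw [mul_sub, ← Real.exp_add]
    ring_nf
  have hle : 1 - Real.exp (x - y) ≤ y - x := by linarith [Real.add_one_le_exp (x - y)]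
  have hnonneg : 0 ≤ 1 - Real.exp (x - y) :=
    sub_nonneg.2 (Real.exp_le_one_iff.2 (sub_nonpos.2 hxy))
  rw [hfactor, abs_sub_comm, abs_of_nonneg (mul_nonneg (Real.exp_pos _).le hnonneg),
    abs_of_nonneg (sub_nonneg.2 hxy)]
  exact (mul_le_of_le_one_left hnonneg (Real.exp_le_one_iff.2 (neg_nonpos.2 hx))).trans hle

end ProductLimit

section CumHazard

/-- The cumulative hazard `∫_{-∞}^t dρ(s) / ν([s, ∞))`, where `ρ` is the subdistribution of the
uncensored observations and `ν` the distribution of all observations. For empirical measures this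
is the Nelson–Aalen estimator. -/
noncomputable def cumHazard (ρ ν : Measure ℝ) (t : ℝ) : ℝ := ∫ s in Iic t, (ν.real (Ici s))⁻¹ ∂ρ

lemma cumHazard_nonneg {ρ ν : Measure ℝ} {t : ℝ} : 0 ≤ cumHazard ρ ν t :=
  integral_nonneg fun _ => inv_nonneg.2 measureReal_nonneg

variable {ρ ρ' ν ν' : Measure ℝ} [IsFiniteMeasure ρ] [IsFiniteMeasure ρ'] [IsFiniteMeasure ν]
  [IsFiniteMeasure ν'] {t ε a a' : ℝ}

lemma le_measureReal_Ici (ha : a ≤ ν.real (Ici t)) {s : ℝ} (hs : s ≤ t) : a ≤ ν.real (Ici s) :=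
  ha.trans (measureReal_mono (Ici_subset_Ici.2 hs))

lemma inv_measureReal_Ici_mem_Icc (ha0 : 0 < a) (ha : a ≤ ν.real (Ici t)) {s : ℝ} (hs : s ≤ t) :
    (ν.real (Ici s))⁻¹ ∈ Icc 0 a⁻¹ :=
  ⟨inv_nonneg.2 measureReal_nonneg, inv_anti₀ ha0 (le_measureReal_Ici ha hs)⟩

lemma quasiconcaveOn_inv_measureReal_Ici (ha0 : 0 < a) (ha : a ≤ ν.real (Ici t)) :
    QuasiconcaveOn ℝ (Iic t) fun s => (ν.real (Ici s))⁻¹ :=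
  MonotoneOn.quasiconcaveOn (fun _ _ _ hs hrs => inv_anti₀ (ha0.trans_le (le_measureReal_Ici ha hs))
    (measureReal_mono (Ici_subset_Ici.2 hrs))) (convex_Iic t)

lemma integrableOn_inv_measureReal_Ici (ha0 : 0 < a) (ha : a ≤ ν.real (Ici t)) :
    IntegrableOn (fun s => (ν.real (Ici s))⁻¹) (Iic t) ρ :=
  integrableOn_of_quasiconcaveOn (quasiconcaveOn_inv_measureReal_Ici ha0 ha) ordConnected_Iic
    (fun _ hs => have := inv_measureReal_Ici_mem_Icc ha0 ha hs
      (abs_of_nonneg this.1).trans_le this.2) ρ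

lemma abs_setIntegral_le_of_measureReal_le_one (hρ : ρ.real univ ≤ 1) {s : Set ℝ} {φ : ℝ → ℝ}
    {C : ℝ} (hC0 : 0 ≤ C) (hC : ∀ x ∈ s, |φ x| ≤ C) : |∫ x in s, φ x ∂ρ| ≤ C :=
  (norm_setIntegral_le_of_norm_le_const (f := φ) (measure_lt_top ρ s) hC).trans
    (mul_le_of_le_one_right hC0 ((measureReal_mono (subset_univ s)).trans hρ))

lemma cumHazard_le (hρ : ρ.real univ ≤ 1) (ha0 : 0 < a) (ha : a ≤ ν.real (Ici t)) :
    cumHazard ρ ν t ≤ a⁻¹ :=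
  (le_abs_self _).trans <| abs_setIntegral_le_of_measureReal_le_one hρ (inv_nonneg.2 ha0.le)
    fun _ hs => have := inv_measureReal_Ici_mem_Icc ha0 ha hs
      (abs_of_nonneg this.1).trans_le this.2

lemma CdfDistLE.abs_cumHazard_sub_le (h : CdfDistLE ρ ρ' t ε) (ha0 : 0 < a)
    (ha : a ≤ ν.real (Ici t)) : |cumHazard ρ ν t - cumHazard ρ' ν t| ≤ 2 * ε * a⁻¹ :=
  h.abs_setIntegral_sub_le_of_quasiconcaveOn ordConnected_Iic subset_rfl
    (quasiconcaveOn_inv_measureReal_Ici ha0 ha)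
    (fun _ hs => (inv_measureReal_Ici_mem_Icc ha0 ha hs).1)
    (fun _ hs => (inv_measureReal_Ici_mem_Icc ha0 ha hs).2) (inv_nonneg.2 ha0.le)

lemma abs_cumHazard_sub_le_of_forall_Ici (hρ : ρ.real univ ≤ 1) (hε : 0 ≤ ε)
    (h : ∀ s ≤ t, |ν.real (Ici s) - ν'.real (Ici s)| ≤ ε) (ha0 : 0 < a) (ha : a ≤ ν.real (Ici t))
    (ha0' : 0 < a') (ha' : a' ≤ ν'.real (Ici t)) :
    |cumHazard ρ ν t - cumHazard ρ ν' t| ≤ ε / (a * a') := by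
  rw [cumHazard, cumHazard, ← integral_sub (integrableOn_inv_measureReal_Ici ha0 ha)
    (integrableOn_inv_measureReal_Ici ha0' ha')]
  refine abs_setIntegral_le_of_measureReal_le_one hρ (by positivity) fun s hs => ?_
  have hνs := le_measureReal_Ici ha hs
  have hνs' := le_measureReal_Ici ha' hs
  have hpos := ha0.trans_le hνs
  have hpos' := ha0'.trans_le hνs'
  rw [inv_sub_inv hpos.ne' hpos'.ne', abs_div, abs_of_pos (mul_pos hpos hpos'), abs_sub_comm]
  gcongr
  exact h s hs

lemma CdfDistLE.abs_measureReal_Ici_sub_le (h : CdfDistLE ν ν' t ε)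
    (huniv : ν.real univ = ν'.real univ) {s : ℝ} (hs : s ≤ t) :
    |ν.real (Ici s) - ν'.real (Ici s)| ≤ ε := by
  rw [← compl_Iio, measureReal_compl measurableSet_Iio, measureReal_compl measurableSet_Iio, huniv,
    sub_sub_sub_cancel_left, abs_sub_comm]
  exact h.abs_measureReal_Iio_sub_le hs

end CumHazard

section KaplanMeier

variable {D : Set (ℝ × ℝ)} {V : ℝ × ℝ → ℝ} {n : ℕ} {t ε a : ℝ}

lemma eventJump_div_atRisk (hD : MeasurableSet D) (hV : Measurable V) (hn : n ≠ 0)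
    (z : ℕ → ℝ × ℝ) (s : ℝ) :
    (eventJump n (fun i => V (z i)) (fun i => z i ∈ D) s : ℝ) / atRisk n (fun i => V (z i)) s =
      (subLaw (empMeasure n z) D V).real {s} *
        ((subLaw (empMeasure n z) univ V).real (Ici s))⁻¹ := by
  rw [subLaw_empMeasure_real_singleton hD hV, subLaw_empMeasure_univ_real_Ici hV]
  field_simp

lemma sum_eventJump_div_atRisk (hD : MeasurableSet D) (hV : Measurable V) (hn : n ≠ 0)
    (z : ℕ → ℝ × ℝ) (t : ℝ) :
    ∑ s ∈ ((Finset.range n).image fun i => V (z i)).filter (· ≤ t),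
      (eventJump n (fun i => V (z i)) (fun i => z i ∈ D) s : ℝ) / atRisk n (fun i => V (z i)) s =
      cumHazard (subLaw (empMeasure n z) D V) (subLaw (empMeasure n z) univ V) t := by
  have hanti : Antitone fun s => (subLaw (empMeasure n z) univ V).real (Ici s) :=
    fun _ _ h => measureReal_mono (Ici_subset_Ici.2 h)
  rw [cumHazard, setIntegral_Iic_subLaw_empMeasure hD hV n z
    (g := fun s => ((subLaw (empMeasure n z) univ V).real (Ici s))⁻¹) hanti.measurable.inv,
    Finset.mul_sum]
  refine Finset.sum_congr rfl fun s _ => ?_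
  rw [eventJump_div_atRisk hD hV hn, subLaw_empMeasure_real_singleton hD hV, mul_assoc]

lemma abs_kmSurv_sub_exp_neg_nelsonAalen_le (hD : MeasurableSet D) (hV : Measurable V)
    (hn : n ≠ 0) (z : ℕ → ℝ × ℝ) {ρ : Measure ℝ} [IsFiniteMeasure ρ] [NullSingletonClass ρ]
    (hρ : CdfDistLE (subLaw (empMeasure n z) D V) ρ t ε) (ha0 : 0 < a)
    (ha : a ≤ (subLaw (empMeasure n z) univ V).real (Ici t)) :
    |kmSurv n (fun i => V (z i)) (fun i => z i ∈ D) t -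
      Real.exp (-cumHazard (subLaw (empMeasure n z) D V) (subLaw (empMeasure n z) univ V) t)| ≤
      2 * ε * a⁻¹ *
        cumHazard (subLaw (empMeasure n z) D V) (subLaw (empMeasure n z) univ V) t := by
  rw [← sum_eventJump_div_atRisk hD hV hn]
  refine abs_prod_one_sub_sub_exp_le _ (fun s _ => ⟨by positivity,
    sub_nonneg.1 (kmFactor_mem n _ _ s).1⟩) fun s hs => ?_
  have hst : s ≤ t := (Finset.mem_filter.1 hs).2
  have hjump : (subLaw (empMeasure n z) D V).real {s} ≤ 2 * ε := by
    have := hρ.abs_measureReal_sub_le_of_ordConnected ordConnected_singleton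
      (singleton_subset_iff.2 hst)
    rwa [measureReal_def ρ, measure_singleton, ENNReal.toReal_zero, sub_zero,
      abs_of_nonneg measureReal_nonneg] at this
  rw [eventJump_div_atRisk hD hV hn]
  have hinv := inv_measureReal_Ici_mem_Icc ha0 ha hst
  exact mul_le_mul hjump hinv.2 hinv.1 (measureReal_nonneg.trans hjump)

/-- The three terms are the errors of replacing the product by an exponential, the number at risk
by its limit, and the counting process of the uncensored observations by its limit. -/
lemma abs_kmSurv_sub_exp_neg_cumHazard_le (hD : MeasurableSet D) (hV : Measurable V)
    (hn : n ≠ 0) (z : ℕ → ℝ × ℝ) {ρ ν : Measure ℝ} [IsFiniteMeasure ρ] [NullSingletonClass ρ]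
    [IsProbabilityMeasure ν] (hρ : CdfDistLE (subLaw (empMeasure n z) D V) ρ t ε)
    (hν : CdfDistLE (subLaw (empMeasure n z) univ V) ν t ε) (ha0 : 0 < a)
    (ha : a ≤ ν.real (Ici t)) (hεa : ε ≤ a / 2) :
    |kmSurv n (fun i => V (z i)) (fun i => z i ∈ D) t - Real.exp (-cumHazard ρ ν t)| ≤
      12 / a ^ 2 * ε := by
  have := isProbabilityMeasure_empMeasure hn z
  set ρn := subLaw (empMeasure n z) D V
  set νn := subLaw (empMeasure n z) univ V
  have hε : 0 ≤ ε := hρ.nonneg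
  have ha1 : a ≤ 1 := ha.trans measureReal_le_one
  have hρn : ρn.real univ ≤ 1 := (subLaw_real hV .univ).trans_le measureReal_le_one
  have hνn : νn.real univ = ν.real univ := by simp [νn, subLaw_real hV .univ]
  have hIci (s : ℝ) (hs : s ≤ t) := hν.abs_measureReal_Ici_sub_le hνn hs
  have han0 : 0 < a / 2 := half_pos ha0
  have han : a / 2 ≤ νn.real (Ici t) := by linarith [(abs_le.1 (hIci t le_rfl)).1]
  have product : |kmSurv n (fun i => V (z i)) (fun i => z i ∈ D) t -
      Real.exp (-cumHazard ρn νn t)| ≤ 8 / a ^ 2 * ε :=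
    calc _ ≤ 2 * ε * (a / 2)⁻¹ * cumHazard ρn νn t :=
          abs_kmSurv_sub_exp_neg_nelsonAalen_le hD hV hn z hρ han0 han
      _ ≤ 2 * ε * (a / 2)⁻¹ * (a / 2)⁻¹ := by
          gcongr
          exact cumHazard_le hρn han0 han
      _ = 8 / a ^ 2 * ε := by ring
  have at_risk : |cumHazard ρn νn t - cumHazard ρn ν t| ≤ 2 / a ^ 2 * ε :=
    (abs_cumHazard_sub_le_of_forall_Ici hρn hε hIci han0 han ha0 ha).trans_eq (by field_simp)
  have counting : |cumHazard ρn ν t - cumHazard ρ ν t| ≤ 2 / a ^ 2 * ε :=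
    calc _ ≤ 2 * ε * a⁻¹ := hρ.abs_cumHazard_sub_le ha0 ha
      _ ≤ 2 * ε * (a ^ 2)⁻¹ := by
        gcongr
        exact pow_le_of_le_one ha0.le ha1 two_ne_zero
      _ = 2 / a ^ 2 * ε := by ring
  calc _ ≤ _ + |Real.exp (-cumHazard ρn νn t) - Real.exp (-cumHazard ρ ν t)| := abs_sub_le _ _ _
    _ ≤ 8 / a ^ 2 * ε + (2 / a ^ 2 * ε + 2 / a ^ 2 * ε) :=
        add_le_add product ((abs_exp_neg_sub_exp_neg_le cumHazard_nonneg cumHazard_nonneg).trans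
          ((abs_sub_le _ _ _).trans (add_le_add at_risk counting)))
    _ = 12 / a ^ 2 * ε := by ring

end KaplanMeier

section RandomCensoring

/-- The pairs (lifetime, censoring time) that lead to an uncensored observation. -/
def uncensoredSet : Set (ℝ × ℝ) := {z | z.1 ≤ z.2}

lemma measurableSet_uncensoredSet : MeasurableSet uncensoredSet :=
  measurableSet_le measurable_fst measurable_snd

/-- The observed time of a pair (lifetime, censoring time). -/
def minPair (z : ℝ × ℝ) : ℝ := min z.1 z.2

lemma measurable_minPair : Measurable minPair := measurable_fst.min measurable_snd

section SFinite

variable (P Q : Measure ℝ) [SFinite Q]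

lemma subLaw_uncensoredSet_minPair :
    subLaw (P.prod Q) uncensoredSet minPair = P.withDensity fun x => Q (Ici x) := by
  ext A hA
  have hAm := (measurable_minPair hA).inter measurableSet_uncensoredSet
  rw [subLaw, Measure.map_apply measurable_minPair hA,
    Measure.restrict_apply (measurable_minPair hA), Measure.prod_apply hAm, withDensity_apply _ hA,
    ← lintegral_indicator hA]
  refine lintegral_congr fun x => ?_
  have hfibre (y : ℝ) : (x, y) ∈ minPair ⁻¹' A ∩ uncensoredSet ↔ x ∈ A ∧ x ≤ y := by
    simp +contextual [minPair, uncensoredSet, and_congr_left_iff]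
  by_cases hx : x ∈ A
  · rw [indicator_of_mem hx]
    congr 1
    ext y
    exact (hfibre y).trans (and_iff_right hx)
  · rw [indicator_of_notMem hx, measure_eq_zero_iff_ae_notMem]
    exact .of_forall fun y hy => hx ((hfibre y).1 hy).1

instance [NullSingletonClass P] : NullSingletonClass (subLaw (P.prod Q) uncensoredSet minPair) :=
  subLaw_uncensoredSet_minPair P Q ▸ inferInstance

lemma subLaw_univ_minPair_real_Ici (s : ℝ) :
    (subLaw (P.prod Q) univ minPair).real (Ici s) = P.real (Ici s) * Q.real (Ici s) := by
  rw [subLaw_real measurable_minPair measurableSet_Ici, inter_univ, ← measureReal_prod_prod]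
  congr 1
  ext z
  exact le_min_iff (a := z.1) (b := z.2) (c := s)

end SFinite

variable (P Q : Measure ℝ) [IsProbabilityMeasure P] [IsProbabilityMeasure Q] {t : ℝ}

instance : IsProbabilityMeasure (subLaw (P.prod Q) univ minPair) := by
  rw [subLaw, Measure.restrict_univ]
  exact Measure.isProbabilityMeasure_map measurable_minPair.aemeasurable

/-- The factor `Q [s, ∞)` by which censoring thins the uncensored observations cancels against the
same factor in the number at risk. -/
lemma cumHazard_subLaw_minPair [NullSingletonClass P] (ht : 0 < P.real (Ici t) * Q.real (Ici t)) :
    cumHazard (subLaw (P.prod Q) uncensoredSet minPair) (subLaw (P.prod Q) univ minPair) t =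
      -Real.log (P.real (Ioi t)) := by
  have hP : 0 < P.real (Ioi t) :=
    (pos_of_mul_pos_left ht measureReal_nonneg).trans_eq (measureReal_congr Ioi_ae_eq_Ici).symm
  have hanti : Antitone fun x => Q (Ici x) := fun x y h => measure_mono (Ici_subset_Ici.2 h)
  rw [← setIntegral_Iic_inv_measureReal_Ici hP, cumHazard, subLaw_uncensoredSet_minPair,
    setIntegral_withDensity_eq_setIntegral_toReal_smul hanti.measurable
      (.of_forall fun x => measure_lt_top Q _) _ measurableSet_Iic]
  refine setIntegral_congr_fun measurableSet_Iic fun x (hx : x ≤ t) => ?_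
  have hQ : 0 < Q.real (Ici x) := (pos_of_mul_pos_right ht measureReal_nonneg).trans_le
    (measureReal_mono (Ici_subset_Ici.2 hx))
  change Q.real (Ici x) * _ = _
  rw [subLaw_univ_minPair_real_Ici, mul_inv, mul_left_comm, mul_inv_cancel₀ hQ.ne', mul_one]

lemma abs_kmSurv_minPair_sub_le [NullSingletonClass P] {n : ℕ} (hn : n ≠ 0) (z : ℕ → ℝ × ℝ)
    {ε a : ℝ} (hρ : CdfDistLE (subLaw (empMeasure n z) uncensoredSet minPair)
      (subLaw (P.prod Q) uncensoredSet minPair) t ε)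
    (hν : CdfDistLE (subLaw (empMeasure n z) univ minPair) (subLaw (P.prod Q) univ minPair) t ε)
    (ha0 : 0 < a) (ha : a ≤ P.real (Ici t) * Q.real (Ici t)) (hεa : ε ≤ a / 2) :
    |kmSurv n (fun i => minPair (z i)) (fun i => z i ∈ uncensoredSet) t - P.real (Ioi t)| ≤
      12 / a ^ 2 * ε := by
  have hPQ := ha0.trans_le ha
  have hP : 0 < P.real (Ioi t) :=
    (pos_of_mul_pos_left hPQ measureReal_nonneg).trans_eq (measureReal_congr Ioi_ae_eq_Ici).symm
  have h := abs_kmSurv_sub_exp_neg_cumHazard_le measurableSet_uncensoredSet measurable_minPair hn z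
    hρ hν ha0 (ha.trans_eq (subLaw_univ_minPair_real_Ici P Q t).symm) hεa
  rwa [cumHazard_subLaw_minPair P Q hPQ, neg_neg, Real.exp_log hP] at h

end RandomCensoring

section ObservationSets

variable {A : Set ℝ}

lemma biMonotone_mem_minPair_preimage (hA : IsLowerSet A) :
    BiMonotone (· ∈ minPair ⁻¹' A ∩ univ) where
  left := .inr fun y _ _ ht h => ⟨hA (min_le_min_right y ht) h.1, mem_univ _⟩
  right := .inr fun t _ _ hy h => ⟨hA (min_le_min_left t hy) h.1, mem_univ _⟩

lemma biMonotone_mem_minPair_preimage_inter_uncensoredSet (hA : IsLowerSet A) :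
    BiMonotone (· ∈ minPair ⁻¹' A ∩ uncensoredSet) where
  left := .inr fun y _ _ ht h => ⟨hA (min_le_min_right y ht) h.1, le_trans ht h.2⟩
  right := .inl fun t _ _ hy h =>
    ⟨hA ((min_le_left t _).trans_eq (min_eq_left h.2).symm) h.1, le_trans h.2 hy⟩

lemma biMonotone_mem_fst_preimage {β : Type*} [Preorder β] (hA : IsLowerSet A) :
    BiMonotone fun z : ℝ × β => z ∈ Prod.fst ⁻¹' A ∩ univ where
  left := .inr fun _ _ _ ht h => ⟨hA ht h.1, mem_univ _⟩
  right := .inl fun _ _ _ _ h => h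

end ObservationSets

section KaplanMeierMeasure

variable (n : ℕ) (x : ℕ → ℝ) (δ : ℕ → Prop)

lemma kmSurv_mem_Icc (t : ℝ) : kmSurv n x δ t ∈ Icc 0 1 :=
  ⟨Finset.prod_nonneg fun s _ => (kmFactor_mem n x δ s).1,
    Finset.prod_le_one (fun s _ => (kmFactor_mem n x δ s).1) fun s _ => (kmFactor_mem n x δ s).2⟩

lemma tendsto_kmCDF_atBot : Tendsto (kmCDF n x δ) atBot (𝓝 0) := by
  refine tendsto_const_nhds.congr' ?_
  have below : ∀ᶠ t in atBot, ∀ s ∈ (Finset.range n).image x, t < s :=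
    (Filter.eventually_all_finset _).2 fun s _ => eventually_lt_atBot s
  filter_upwards [below] with t ht
  have hempty : ((Finset.range n).image x).filter (· ≤ t) = ∅ :=
    Finset.filter_eq_empty_iff.2 fun s hs => (ht s hs).not_ge
  change 0 = 1 - kmSurv n x δ t
  rw [kmSurv, hempty, Finset.prod_empty, sub_self]

lemma measure_kmCDF_Iic (t : ℝ) :
    (kmCDF n x δ).measure (Iic t) = ENNReal.ofReal (1 - kmSurv n x δ t) := by
  rw [StieltjesFunction.measure_Iic _ (tendsto_kmCDF_atBot n x δ), sub_zero]
  rfl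

instance : IsFiniteMeasure (kmCDF n x δ).measure :=
  ⟨(le_of_tendsto' (tendsto_measure_Iic_atTop _) fun t => (measure_kmCDF_Iic n x δ t).trans_le
    (ENNReal.ofReal_le_ofReal (sub_le_self 1 (kmSurv_mem_Icc n x δ t).1))).trans_lt
    ENNReal.ofReal_lt_top⟩

lemma measureReal_kmCDF_Iic (t : ℝ) :
    (kmCDF n x δ).measure.real (Iic t) = 1 - kmSurv n x δ t := by
  rw [measureReal_def, measure_kmCDF_Iic,
    ENNReal.toReal_ofReal (sub_nonneg.2 (kmSurv_mem_Icc n x δ t).2)]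

end KaplanMeierMeasure

section Linearization

variable {Ω : Type*} [MeasurableSpace Ω] {μ : Measure Ω} [IsProbabilityMeasure μ]
  {T Y : ℕ → Ω → ℝ} {P Q : Measure ℝ} {k : ℝ → ℝ} {r s : ℝ}

namespace CensoredModel

lemma ae_eventually_cdfDistLE_kmCDF [NullSingletonClass P] (h : CensoredModel μ T Y P Q) {c : ℝ}
    (hc : 0 < P.real (Ici c) * Q.real (Ici c)) :
    ∀ᵐ ω ∂μ, ∀ᶠ n in atTop,
      CdfDistLE (kmCDF n (fun i => obs T Y i ω) fun i => uncensored T Y i ω).measure P c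
        (12 / (P.real (Ici c) * Q.real (Ici c)) ^ 2 * (3 * rate n)) := by
  have := h.isProbabilityMeasure_left
  have := h.isProbabilityMeasure_right
  have rate_small : ∀ᶠ n in atTop, 3 * rate n ≤ P.real (Ici c) * Q.real (Ici c) / 2 :=
    (mul_zero (3 : ℝ) ▸ tendsto_rate.const_mul 3).eventually_le_const (half_pos hc)
  filter_upwards [h.ae_eventually_forall_cdfDistLE measurableSet_uncensoredSet measurable_minPair
      fun A hA => biMonotone_mem_minPair_preimage_inter_uncensoredSet hA,
    h.ae_eventually_forall_cdfDistLE .univ measurable_minPair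
      fun A hA => biMonotone_mem_minPair_preimage hA] with ω hρ hν
  filter_upwards [hρ, hν, rate_small, eventually_ne_atTop 0] with n hρ hν hε hn x hx
  have hIic : P.real (Iic x) = 1 - P.real (Ioi x) := by
    rw [← compl_Ioi, probReal_compl_eq_one_sub measurableSet_Ioi]
  rw [measureReal_kmCDF_Iic, hIic, sub_sub_sub_cancel_left, abs_sub_comm]
  exact abs_kmSurv_minPair_sub_le P Q hn (fun i => (T i ω, Y i ω)) (hρ x) (hν x) hc
    (mul_le_mul (measureReal_mono (Ici_subset_Ici.2 hx)) (measureReal_mono (Ici_subset_Ici.2 hx))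
      measureReal_nonneg measureReal_nonneg) hε

lemma integral_integral_empMeasure (h : CensoredModel μ T Y P Q) {n : ℕ} (hn : n ≠ 0)
    {H : ℝ × ℝ → ℝ} (hH : Integrable H (P.prod Q)) :
    ∫ ω, ∫ z, H z ∂empMeasure n (fun i => (T i ω, Y i ω)) ∂μ = ∫ z, H z ∂P.prod Q := by
  have hint (i : ℕ) : Integrable (fun ω => H (T i ω, Y i ω)) μ := by
    rw [← h.map_pair i] at hH
    exact hH.comp_measurable (h.measurable_pair i)
  have hmean (i : ℕ) : ∫ ω, H (T i ω, Y i ω) ∂μ = ∫ z, H z ∂P.prod Q := by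
    rw [← h.map_pair i] at hH ⊢
    rw [integral_map (h.measurable_pair i).aemeasurable hH.1]
  simp only [integral_empMeasure]
  rw [integral_const_mul, integral_finsetSum _ fun i _ => hint i]
  simp only [hmean, Finset.sum_const, Finset.card_range, nsmul_eq_mul]
  exact inv_mul_cancel_left₀ (Nat.cast_ne_zero.2 hn) _

variable {D : Set (ℝ × ℝ)} {V : ℝ × ℝ → ℝ}

lemma integral_smooth_subLaw_empMeasure (h : CensoredModel μ T Y P Q) (hD : MeasurableSet D)
    (hV : Measurable V) (hk : Measurable k) {M : ℝ} (hM : ∀ u, |k u| ≤ M) {n : ℕ} (hn : n ≠ 0)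
    (b a t : ℝ) :
    ∫ ω, smooth k b a (subLaw (empMeasure n fun i => (T i ω, Y i ω)) D V) t ∂μ =
      smooth k b a (subLaw (P.prod Q) D V) t := by
  have := h.isProbabilityMeasure_left
  have := h.isProbabilityMeasure_right
  set φ : ℝ → ℝ := (Ici a).indicator fun x => k ((t - x) / b)
  have hφ : Measurable φ := (hk.comp (by fun_prop)).indicator measurableSet_Ici
  have hint : Integrable (D.indicator fun z => φ (V z)) (P.prod Q) :=
    .of_bound ((hφ.comp hV).indicator hD).aestronglyMeasurable M <| .of_forall fun z =>
      (norm_indicator_le_norm_self _ _).trans ((norm_indicator_le_norm_self _ _).trans (hM _))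
  simp only [smooth, ← integral_indicator measurableSet_Ici]
  rw [integral_const_mul, integral_subLaw hD hV hφ, ← h.integral_integral_empMeasure hn hint]
  simp only [φ, integral_subLaw hD hV hφ]

variable (hk : BoundedVariationOn k (Ioo r s)) (hk0 : ∀ u ∉ Ioo r s, k u = 0) {b : ℕ → ℝ}
  (hb : ∀ᶠ n in atTop, 0 < b n) (a : ℝ)
include hk hk0 hb

lemma exists_ae_eventually_abs_smooth_kmCDF_sub_le [NullSingletonClass P]
    (h : CensoredModel μ T Y P Q) (hb0 : Tendsto b atTop (𝓝 0)) {τ c : ℝ} (hτc : τ < c)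
    (hc : 0 < P.real (Ici c) * Q.real (Ici c)) :
    ∃ K, ∀ᵐ ω ∂μ, ∀ᶠ n in atTop, ∀ t ≤ τ,
      |kernelSmooth k (b n) a (kmCDF n (fun i => obs T Y i ω) fun i => uncensored T Y i ω) t -
        smooth k (b n) a P t| ≤ K * ((b n)⁻¹ * rate n) := by
  have := h.isProbabilityMeasure_left
  obtain ⟨K, -, hK⟩ := exists_abs_smooth_sub_le hk hk0
  have window : ∀ᶠ n in atTop, τ - r * b n ≤ c :=
    (by simpa using (hb0.const_mul r).const_sub τ :
      Tendsto (fun n => τ - r * b n) atTop (𝓝 τ)).eventually_le_const hτc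
  refine ⟨K * (12 / (P.real (Ici c) * Q.real (Ici c)) ^ 2 * 3), ?_⟩
  filter_upwards [h.ae_eventually_cdfDistLE_kmCDF hc] with ω hω
  filter_upwards [hω, hb, window] with n hω hb hw t ht
  exact (hK _ P a (b n) c t _ hω hb (by linarith)).trans_eq (by ring)

lemma exists_ae_eventually_abs_smooth_empCDF_sub_integral_le (h : CensoredModel μ T Y P Q)
    (hD : MeasurableSet D) (hV : Measurable V)
    (hVD : ∀ A, IsLowerSet A → BiMonotone (· ∈ V ⁻¹' A ∩ D)) :
    ∃ K, 0 ≤ K ∧ ∀ᵐ ω ∂μ, ∀ᶠ n in atTop, ∀ t,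
      |kernelSmooth k (b n) a (empCDF n (fun i => V (T i ω, Y i ω))
          fun i => (T i ω, Y i ω) ∈ D) t -
        ∫ ω', kernelSmooth k (b n) a (empCDF n (fun i => V (T i ω', Y i ω'))
          fun i => (T i ω', Y i ω') ∈ D) t ∂μ| ≤ K * ((b n)⁻¹ * rate n) := by
  have := h.isProbabilityMeasure_left
  have := h.isProbabilityMeasure_right
  obtain ⟨K, hK0, hK⟩ := exists_abs_smooth_sub_le hk hk0
  obtain ⟨M, hM⟩ := exists_bound_of_boundedVariationOn_Ioo hk hk0
  have hkm := measurable_of_boundedVariationOn_Ioo hk hk0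
  have smooth_empCDF (n : ℕ) (t : ℝ) (ω : Ω) :
      kernelSmooth k (b n) a (empCDF n (fun i => V (T i ω, Y i ω)) fun i => (T i ω, Y i ω) ∈ D) t =
        smooth k (b n) a (subLaw (empMeasure n fun i => (T i ω, Y i ω)) D V) t := by
    rw [← measure_empCDF hD hV, smooth, kernelSmooth]
  refine ⟨K * 3, by positivity, ?_⟩
  filter_upwards [h.ae_eventually_forall_cdfDistLE hD hV hVD] with ω hω
  filter_upwards [hω, hb, eventually_ne_atTop 0] with n hω hb hn t
  simp only [smooth_empCDF]
  rw [h.integral_smooth_subLaw_empMeasure hD hV hkm hM hn]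
  exact (hK _ _ a (b n) _ t _ (hω _) hb le_rfl).trans_eq (by ring)

lemma exists_ae_eventually_abs_linearization_le [NullSingletonClass P]
    (h : CensoredModel μ T Y P Q) (hb0 : Tendsto b atTop (𝓝 0)) {τ c : ℝ} (hτc : τ < c)
    (hc : 0 < P.real (Ici c) * Q.real (Ici c)) (hD : MeasurableSet D) (hV : Measurable V)
    (hVD : ∀ A, IsLowerSet A → BiMonotone (· ∈ V ⁻¹' A ∩ D)) :
    ∃ C, ∀ᵐ ω ∂μ, ∀ᶠ n in atTop, ∀ t ≤ τ,
      |kernelSmooth k (b n) a (kmCDF n (fun i => obs T Y i ω) fun i => uncensored T Y i ω) t -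
          smooth k (b n) a P t -
        (kernelSmooth k (b n) a (empCDF n (fun i => V (T i ω, Y i ω))
            fun i => (T i ω, Y i ω) ∈ D) t -
          ∫ ω', kernelSmooth k (b n) a (empCDF n (fun i => V (T i ω', Y i ω'))
            fun i => (T i ω', Y i ω') ∈ D) t ∂μ) / Q.real (Ioi t)| ≤
        C * ((b n)⁻¹ * rate n) := by
  have := h.isProbabilityMeasure_right
  have hQc : 0 < Q.real (Ici c) := pos_of_mul_pos_right hc measureReal_nonneg
  obtain ⟨K₁, hK₁⟩ := h.exists_ae_eventually_abs_smooth_kmCDF_sub_le hk hk0 hb a hb0 hτc hc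
  obtain ⟨K₂, hK₂0, hK₂⟩ :=
    h.exists_ae_eventually_abs_smooth_empCDF_sub_integral_le hk hk0 hb a hD hV hVD
  refine ⟨K₁ + K₂ / Q.real (Ici c), ?_⟩
  filter_upwards [hK₁, hK₂] with ω hK₁ hK₂
  filter_upwards [hK₁, hK₂, hb] with n hK₁ hK₂ hb t ht
  have hQt : Q.real (Ici c) ≤ Q.real (Ioi t) :=
    measureReal_mono (Ici_subset_Ioi.2 (ht.trans_lt hτc))
  have hrate := rate_nonneg n
  calc _ ≤ _ + _ := abs_sub _ _
    _ ≤ K₁ * ((b n)⁻¹ * rate n) + K₂ * ((b n)⁻¹ * rate n) / Q.real (Ici c) := by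
        rw [abs_div, abs_of_pos (hQc.trans_le hQt)]
        gcongr
        · exact hK₁ t ht
        · exact hK₂ t
    _ = (K₁ + K₂ / Q.real (Ici c)) * ((b n)⁻¹ * rate n) := by ring

end CensoredModel

end Linearization

section Laws

variable {Ω : Type*} [MeasurableSpace Ω] {μ : Measure Ω} [IsProbabilityMeasure μ]

lemma map_eq_stieltjesMeasure {Z : Ω → ℝ} (hZ : Measurable Z) {H : StieltjesFunction ℝ}
    (hH : ∀ x, μ.real {ω | Z ω ≤ x} = H x) : μ.map Z = H.measure := by
  have := Measure.isProbabilityMeasure_map (μ := μ) hZ.aemeasurable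
  have hcdf : H = cdf (μ.map Z) := by
    ext x
    rw [cdf_eq_real, map_measureReal_apply hZ measurableSet_Iic]
    exact (hH x).symm
  rw [hcdf, measure_cdf]

lemma stieltjesMeasure_real_Ioi {Z : Ω → ℝ} (hZ : Measurable Z) {H : StieltjesFunction ℝ}
    (hH : ∀ x, μ.real {ω | Z ω ≤ x} = H x) (x : ℝ) : H.measure.real (Ioi x) = 1 - H x := by
  rw [← map_eq_stieltjesMeasure hZ hH, map_measureReal_apply hZ measurableSet_Ioi, ← compl_Iic,
    preimage_compl, probReal_compl_eq_one_sub (hZ measurableSet_Iic), ← hH x]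
  rfl

lemma nullSingletonClass_stieltjesMeasure {H : StieltjesFunction ℝ} (hH : Continuous H) :
    NullSingletonClass H.measure where
  measure_singleton x := by
    rw [StieltjesFunction.measure_singleton, hH.continuousAt.continuousWithinAt.leftLim_eq,
      sub_self, ENNReal.ofReal_zero]

lemma CensoredModel.exists_pos_of_lt_rightEndpoint {T Y : ℕ → Ω → ℝ} {P Q : Measure ℝ}
    (h : CensoredModel μ T Y P Q) {τ : ℝ}
    (hτ : (τ : EReal) < rightEndpoint fun x => μ.real {ω | obs T Y 0 ω ≤ x}) :
    ∃ c, τ < c ∧ 0 < P.real (Ici c) * Q.real (Ici c) := by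
  have := h.isProbabilityMeasure_right
  obtain ⟨_, ⟨c, hc, rfl⟩, hτc⟩ := lt_sSup_iff.1 hτ
  have hobs : Measurable (obs T Y 0) := (h.measurable_T 0).min (h.measurable_Y 0)
  refine ⟨c, EReal.coe_lt_coe_iff.1 hτc, ?_⟩
  calc 0 < 1 - μ.real {ω | obs T Y 0 ω ≤ c} := sub_pos.2 hc
    _ = μ.real {ω | obs T Y 0 ω ≤ c}ᶜ :=
        (probReal_compl_eq_one_sub (hobs measurableSet_Iic)).symm
    _ ≤ μ.real (obs T Y 0 ⁻¹' Ici c) :=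
        measureReal_mono fun ω (hω : ¬obs T Y 0 ω ≤ c) => (not_le.1 hω).le
    _ = P.real (Ici c) * Q.real (Ici c) := by
        rw [← subLaw_univ_minPair_real_Ici, subLaw, Measure.restrict_univ, ← h.map_pair 0,
          Measure.map_map measurable_minPair (h.measurable_pair 0),
          map_measureReal_apply (measurable_minPair.comp (h.measurable_pair 0)) measurableSet_Ici]
        rfl

end Laws

end CensoredNA

open CensoredNA in
theorem theorem1_general {Ω : Type*} [MeasurableSpace Ω] (μ : Measure Ω) [IsProbabilityMeasure μ]
    (T Y : ℕ → Ω → ℝ) (hTmeas : ∀ i, Measurable (T i)) (hYmeas : ∀ i, Measurable (Y i))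
    (hTNA : NegAssociated μ T) (hYNA : NegAssociated μ Y)
    (hindep : IndepFun (fun ω i => T i ω) (fun ω i => Y i ω) μ) (F G : StieltjesFunction ℝ)
    (hF : ∀ i x, μ.real {ω | T i ω ≤ x} = F x) (hG : ∀ i x, μ.real {ω | Y i ω ≤ x} = G x)
    (hFcont : Continuous F) (k : ℝ → ℝ) (r s : ℝ) (hk : BoundedVariationOn k (Ioo r s))
    (hk0 : ∀ u ∉ Ioo r s, k u = 0) (a τ : ℝ)
    (hτL : (τ : EReal) < rightEndpoint fun x => μ.real {ω | obs T Y 0 ω ≤ x})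
    (b : ℕ → ℝ) (hb : ∀ᶠ n in atTop, 0 < b n) (hb0 : Tendsto b atTop (𝓝 0)) :
    (∃ C : ℝ, ∀ᵐ ω ∂μ, ∀ᶠ n : ℕ in atTop, ∀ t ≤ τ,
      |kernelSmooth k (b n) a (kmCDF n (fun i => obs T Y i ω) fun i => uncensored T Y i ω) t
          - kernelSmooth k (b n) a F t
          - (kernelSmooth k (b n) a
                (empCDF n (fun i => obs T Y i ω) fun i => uncensored T Y i ω) t
              - ∫ ω', kernelSmooth k (b n) a
                (empCDF n (fun i => obs T Y i ω') fun i => uncensored T Y i ω') t ∂μ)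
            / (1 - G t)|
        ≤ C * ((b n)⁻¹ * Real.sqrt (Real.log n / n))) ∧
    ∃ C : ℝ, ∀ᵐ ω ∂μ, ∀ᶠ n : ℕ in atTop, ∀ t ≤ τ,
      |kernelSmooth k (b n) a (kmCDF n (fun i => obs T Y i ω) fun i => uncensored T Y i ω) t
          - kernelSmooth k (b n) a F t
          - (kernelSmooth k (b n) a (empCDF n (fun i => T i ω) fun _ => True) t
              - ∫ ω', kernelSmooth k (b n) a (empCDF n (fun i => T i ω') fun _ => True) t ∂μ)
            / (1 - G t)|
        ≤ C * ((b n)⁻¹ * Real.sqrt (Real.log n / n)) := by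
  have model : CensoredModel μ T Y F.measure G.measure :=
    { measurable_T := hTmeas
      measurable_Y := hYmeas
      negAssociated_T := hTNA
      negAssociated_Y := hYNA
      indepFun := hindep
      map_T := fun i => map_eq_stieltjesMeasure (hTmeas i) (hF i)
      map_Y := fun i => map_eq_stieltjesMeasure (hYmeas i) (hG i) }
  have := nullSingletonClass_stieltjesMeasure hFcont
  obtain ⟨c, hτc, hc⟩ := model.exists_pos_of_lt_rightEndpoint hτL
  simp only [← stieltjesMeasure_real_Ioi (hYmeas 0) (hG 0)]
  constructor
  · simpa only [smooth, kernelSmooth, rate, obs, uncensored, minPair, uncensoredSet, mem_ofPred_eq]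
      using model.exists_ae_eventually_abs_linearization_le hk hk0 hb a hb0 hτc hc
        measurableSet_uncensoredSet measurable_minPair
        fun A hA => biMonotone_mem_minPair_preimage_inter_uncensoredSet hA
  · simpa only [smooth, kernelSmooth, rate, mem_univ] using
      model.exists_ae_eventually_abs_linearization_le hk hk0 hb a hb0 hτc hc .univ measurable_fst
        fun A hA => biMonotone_mem_fst_preimage hA

theorem theorem1 {Ω : Type*} [MeasurableSpace Ω] (μ : Measure Ω) [IsProbabilityMeasure μ]
    (T Y : ℕ → Ω → ℝ)
    (hTmeas : ∀ i, Measurable (T i)) (hYmeas : ∀ i, Measurable (Y i))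
    (hTnonneg : ∀ i ω, 0 ≤ T i ω) (hYnonneg : ∀ i ω, 0 ≤ Y i ω)
    (hTNA : CensoredNA.NegAssociated μ T) (hYNA : CensoredNA.NegAssociated μ Y)
    (hindep : IndepFun (fun ω i => T i ω) (fun ω i => Y i ω) μ)
    (F G : StieltjesFunction ℝ)
    (hF : ∀ i x, μ.real {ω | T i ω ≤ x} = F x) (hG : ∀ i x, μ.real {ω | Y i ω ≤ x} = G x)
    (hFcont : Continuous F)
    (k : ℝ → ℝ) (r s : ℝ) (hr : r < 0) (hs : 0 < s) (hk : CensoredNA.IsBVKernel k r s)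
    (τ : ℝ) (haτ : CensoredNA.leftEndpoint F < τ)
    (hτL : (τ : EReal) <
      CensoredNA.rightEndpoint (fun x => μ.real {ω | CensoredNA.obs T Y 0 ω ≤ x}))
    (f g : ℝ → ℝ) (hf : CensoredNA.HasBoundedDensityOn F f τ)
    (hg : CensoredNA.HasBoundedDensityOn G g τ)
    (b : ℕ → ℝ) (hbpos : ∀ n, 1 ≤ n → 0 < b n) (hb0 : Tendsto b atTop (𝓝 0))
    (hb : (fun n : ℕ => (b n)⁻¹) =o[atTop] fun n : ℕ => Real.sqrt ((n : ℝ) / Real.log n)) :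
    (∀ᵐ ω ∂μ, ∃ C : ℝ, ∀ᶠ n : ℕ in atTop, ∀ t ∈ Ioc (0 : ℝ) τ,
      |CensoredNA.fHat k b F T Y n t ω - CensoredNA.fBar k b F n t
          - (CensoredNA.fStar k b F T Y n t ω - ∫ ω', CensoredNA.fStar k b F T Y n t ω' ∂μ)
            / (1 - G t)|
        ≤ C * ((b n)⁻¹ * Real.sqrt (Real.log n / n))) ∧
    (∀ᵐ ω ∂μ, ∃ C : ℝ, ∀ᶠ n : ℕ in atTop, ∀ t ∈ Ioc (0 : ℝ) τ,
      |CensoredNA.fHat k b F T Y n t ω - CensoredNA.fBar k b F n t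
          - (CensoredNA.fStarLife k b F T n t ω - ∫ ω', CensoredNA.fStarLife k b F T n t ω' ∂μ)
            / (1 - G t)|
        ≤ C * ((b n)⁻¹ * Real.sqrt (Real.log n / n))) := by
  obtain ⟨⟨C₁, h₁⟩, C₂, h₂⟩ := theorem1_general μ T Y hTmeas hYmeas hTNA hYNA hindep F G hF hG
    hFcont k r s hk.2.2.2 hk.2.1 (CensoredNA.leftEndpoint F) τ hτL b
    ((eventually_ge_atTop 1).mono hbpos) hb0
  exact ⟨h₁.mono fun _ hω => ⟨C₁, hω.mono fun _ hn t ht => hn t ht.2⟩,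
    h₂.mono fun _ hω => ⟨C₂, hω.mono fun _ hn t ht => hn t ht.2⟩⟩
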